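/- Let $u\colon R\to U$ be a flat epimorphism of commutative rings, i.e. a homomorphism of commutative rings such that $U$ is a flat $R$-module and the multiplication map $U\otimes_R U\to U$ is an isomorphism. Let $\mathbb G$ be the set of all ideals $I\subseteq R$ such that $R/I\otimes_R U=0$ (equivalently, $IU=U$). Assume that for every $I\in\mathbb G$ the quotient ring $R/I$ is semilocal of Krull dimension zero, i.e. $R/I$ has only finitely many maximal ideals and all its prime ideals are maximal (this holds in particular for the zero ring). An $R$-module $F$ is called $U$-strongly flat if $\operatorname{Ext}^1_R(F,C)=0$ for every $R$-module $C$ with $\operatorname{Ext}^1_R(U,C)=0$. Let $F$ be a flat $R$-module. Then $F$ is $U$-strongly flat if and only if both of the following conditions hold: (i) the $U$-module $U\otimes_R F$ is projective; (ii) for every ideal $I\in\mathbb G$, the $R/I$-module $F/IF$ is projective. -/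

import Mathlib

open CategoryTheory TensorProduct

universe u

/-- The Gabriel filter of a flat ring epimorphism `R → U`: the set `𝔾` of all ideals `I` of `R`
with `R/I ⊗_R U = 0` (equivalently, `IU = U`). -/
def gabrielFilter (R U : Type u) [CommRing R] [CommRing U] [Algebra R U] : Set (Ideal R) :=
  {I | Subsingleton ((R ⧸ I) ⊗[R] U)}

/-- `T` is semilocal of Krull dimension zero: it has only finitely many maximal ideals, and
every prime ideal is maximal (`Ring.krullDimLE_zero_iff`). The zero ring qualifies. -/
def IsSemilocalOfDimZero (T : Type u) [CommRing T] : Prop :=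
  Finite (MaximalSpectrum T) ∧ Ring.KrullDimLE 0 T

/-- An `R`-module `C` is `U`-weakly cotorsion if `Ext¹_R(U, C) = 0`. -/
def IsWeaklyCotorsion (R U : Type u) [CommRing R] [CommRing U] [Algebra R U]
    (C : Type u) [AddCommGroup C] [Module R C] : Prop :=
  Subsingleton (Abelian.Ext (ModuleCat.of R U) (ModuleCat.of R C) 1)

/-- An `R`-module `F` is `U`-strongly flat if `Ext¹_R(F, C) = 0` for all `U`-weakly cotorsion
`R`-modules `C`. -/
def IsStronglyFlat (R U : Type u) [CommRing R] [CommRing U] [Algebra R U]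
    (F : Type u) [AddCommGroup F] [Module R F] : Prop :=
  ∀ (C : Type u) [AddCommGroup C] [Module R C], IsWeaklyCotorsion R U C →
    Subsingleton (Abelian.Ext (ModuleCat.of R F) (ModuleCat.of R C) 1)

/-! Necessity: modules over `U`, and over `R ⧸ I` with `I` in `𝔾`, are weakly cotorsion, because `U
⊗ U ≅ U` is projective over `U` and `R/I ⊗ U = 0`. If `Ext¹(F, -)` vanishes on all modules over an
`R`-algebra `S`, then `S ⊗ F` lifts along surjections of `S`-modules, so it is projective.

Sufficiency: let `T` and `K` be the kernel and cokernel of `R → U`; both are `𝔾`-torsion. A weakly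
cotorsion `C` is an iterated extension of three pieces. Modulo the elements killed by `T` it is the
kernel of a map `Hom(T, C) → Ext²(K, C)`. Those elements modulo the image of `Hom(U, C)` form
`Ext¹(K, C)`. The image itself is `Hom(U, C)/Hom(K, C)`.

The hypothesis on `𝔾` splits every `𝔾`-torsion `N` into parts local at the maximal ideals `m` of
`𝔾`, so `Hom(N, X)` is a product of contramodules for the elements of `m`
(`isLocalProduct_linearMap`). A Nakayama lemma makes maps between such products diagonal, hence
kernels and cokernels have the same form; this covers the first two pieces. On these products
`Ext¹(F, -)` vanishes by (ii): a finitely generated ideal `J ≤ m` in `𝔾` is treated one generator at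
a time, down to modules over `R ⧸ J` (`extOneVanishes_of_isContramodule`).

For the third piece, `Hom(U, C)` is a `U`-module, so (i) applies, and `Ext²(F, Hom(K, C))` is `Ext¹`
of the syzygy of `F`, which inherits flatness and (ii). -/

theorem LinearMap.exists_comp_eq_of_ker_le {R Y A B : Type*} [CommRing R] [AddCommGroup Y]
    [Module R Y] [AddCommGroup A] [Module R A] [AddCommGroup B] [Module R B]
    {a : Y →ₗ[R] A} (ha : Function.Surjective a) (b : Y →ₗ[R] B) (h : ker a ≤ ker b) :
    ∃ c : A →ₗ[R] B, c ∘ₗ a = b := by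
  refine ⟨(ker a).liftQ b h ∘ₗ (a.quotKerEquivOfSurjective ha).symm.toLinearMap, ?_⟩
  ext y
  have : (a.quotKerEquivOfSurjective ha).symm (a y) = (ker a).mkQ y := by
    rw [LinearEquiv.symm_apply_eq]; rfl
  simp [this]

theorem LinearMap.exists_comp_eq_of_mem_range {R Y A B : Type*} [CommRing R] [AddCommGroup Y]
    [Module R Y] [AddCommGroup A] [Module R A] [AddCommGroup B] [Module R B]
    {i : A →ₗ[R] B} (hi : Function.Injective i) (b : Y →ₗ[R] B) (h : ∀ y, b y ∈ range i) :
    ∃ c : Y →ₗ[R] A, i ∘ₗ c = b := by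
  refine ⟨(LinearEquiv.ofInjective i hi).symm.toLinearMap ∘ₗ
    b.codRestrict (range i) h, ?_⟩
  ext y
  have := (LinearEquiv.ofInjective i hi).apply_symm_apply
    (b.codRestrict (range i) h y)
  exact congrArg Subtype.val this

/-! ### Concrete `Ext¹` through the canonical free cover -/

section

variable (R F : Type u) [CommRing R] [AddCommGroup F] [Module R F]

/-- The canonical free cover of a module: the free module on its elements. -/
def FreeCover (R F : Type u) [CommRing R] : Type u := F →₀ R

noncomputable instance : AddCommGroup (FreeCover R F) :=
  inferInstanceAs (AddCommGroup (F →₀ R))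

noncomputable instance : Module R (FreeCover R F) :=
  inferInstanceAs (Module R (F →₀ R))

instance : Module.Free R (FreeCover R F) :=
  inferInstanceAs (Module.Free R (F →₀ R))

/-- The augmentation of the canonical free cover of a module. -/
noncomputable def freeCover : FreeCover R F →ₗ[R] F :=
  Finsupp.linearCombination R (id : F → F)

theorem freeCover_surjective : Function.Surjective (freeCover R F) :=
  Finsupp.linearCombination_id_surjective R F

/-- The first syzygy of a module in its canonical free cover. -/
def Syzygy : Type u := LinearMap.ker (freeCover R F)

noncomputable instance : AddCommGroup (Syzygy R F) :=
  inferInstanceAs (AddCommGroup (LinearMap.ker (freeCover R F)))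

noncomputable instance : Module R (Syzygy R F) :=
  inferInstanceAs (Module R (LinearMap.ker (freeCover R F)))

/-- The inclusion of the syzygy in the free cover. -/
noncomputable def syzygyInclusion : Syzygy R F →ₗ[R] FreeCover R F :=
  (LinearMap.ker (freeCover R F)).subtype

theorem syzygyInclusion_injective : Function.Injective (syzygyInclusion R F) :=
  Subtype.val_injective

theorem exact_syzygyInclusion_freeCover :
    Function.Exact (syzygyInclusion R F) (freeCover R F) :=
  LinearMap.exact_subtype_ker_map _

end

/-- Concrete vanishing of `Ext¹(F, D)`: maps from the syzygy of `F` to `D` extend to the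
free cover. -/
def ExtOneVanishes (R F D : Type u) [CommRing R] [AddCommGroup F] [Module R F]
    [AddCommGroup D] [Module R D] : Prop :=
  ∀ g : Syzygy R F →ₗ[R] D, ∃ h : FreeCover R F →ₗ[R] D, h ∘ₗ syzygyInclusion R F = g

section

variable {R F D A B : Type u} [CommRing R] [AddCommGroup F] [Module R F] [AddCommGroup D]
  [Module R D] [AddCommGroup A] [Module R A] [AddCommGroup B] [Module R B]

/-- The free cover has no `Ext¹`, so the long exact sequence makes `Ext¹(F, D)` the cokernel of
restriction from the free cover to the syzygy. -/
theorem subsingleton_ext_one_iff :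
    Subsingleton (Abelian.Ext (ModuleCat.of R F) (ModuleCat.of R D) 1) ↔
      ExtOneVanishes R F D := by
  let S : ShortComplex (ModuleCat.{u} R) :=
    ShortComplex.mk (X₁ := ModuleCat.of R (Syzygy R F)) (X₂ := ModuleCat.of R (FreeCover R F))
      (X₃ := ModuleCat.of R F) (ModuleCat.ofHom (syzygyInclusion R F))
      (ModuleCat.ofHom (freeCover R F)) (by
        ext x
        exact (exact_syzygyInclusion_freeCover R F).apply_apply_eq_zero x)
  have hS : S.ShortExact := by
    refine { exact := ?_, mono_f := ?_, epi_g := ?_ }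
    · rw [ShortComplex.ShortExact.moduleCat_exact_iff_function_exact]
      exact exact_syzygyInclusion_freeCover R F
    · rw [ModuleCat.mono_iff_injective]; exact syzygyInclusion_injective R F
    · rw [ModuleCat.epi_iff_surjective]; exact freeCover_surjective R F
  constructor
  · intro hs g
    obtain ⟨x, hx⟩ := Abelian.Ext.contravariant_sequence_exact₁ hS (ModuleCat.of R D)
      (Abelian.Ext.mk₀ (ModuleCat.ofHom g)) (n₁ := 1) rfl (Subsingleton.elim _ _)
    obtain ⟨h, rfl⟩ := (Abelian.Ext.mk₀_bijective _ _).2 x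
    rw [Abelian.Ext.mk₀_comp_mk₀] at hx
    have := (Abelian.Ext.mk₀_bijective _ _).1 hx
    exact ⟨h.hom, congrArg ModuleCat.Hom.hom this⟩
  · intro hv
    refine subsingleton_of_forall_eq 0 fun x => ?_
    have : Projective S.X₂ :=
      ModuleCat.projective_of_free (M := ModuleCat.of R (FreeCover R F))
        (Module.Free.chooseBasis R (FreeCover R F))
    obtain ⟨y, rfl⟩ := Abelian.Ext.contravariant_sequence_exact₃ hS (ModuleCat.of R D) x
      (Abelian.Ext.eq_zero_of_projective _) (n₀ := 0) rfl
    obtain ⟨g, rfl⟩ := (Abelian.Ext.mk₀_bijective _ _).2 y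
    obtain ⟨h, hh⟩ := hv g.hom
    have : g = S.f ≫ ModuleCat.ofHom h := by
      ext z; exact (LinearMap.congr_fun hh z).symm
    rw [this, ← Abelian.Ext.mk₀_comp_mk₀]
    exact hS.extClass_comp_assoc _

theorem ExtOneVanishes.exists_lift (hF : ExtOneVanishes R F D) {i : D →ₗ[R] A} {p : A →ₗ[R] B}
    (hi : Function.Injective i) (hip : Function.Exact i p) (hp : Function.Surjective p)
    (f : F →ₗ[R] B) : ∃ f' : F →ₗ[R] A, p ∘ₗ f' = f := by
  obtain ⟨h, hh⟩ := Module.projective_lifting_property p (f ∘ₗ freeCover R F) hp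
  have hr (y : Syzygy R F) : (h ∘ₗ syzygyInclusion R F) y ∈ LinearMap.range i := by
    refine (hip _).1 ((LinearMap.congr_fun hh _).trans ?_)
    rw [LinearMap.comp_apply, (exact_syzygyInclusion_freeCover R F).apply_apply_eq_zero, map_zero]
  obtain ⟨g, hg⟩ := LinearMap.exists_comp_eq_of_mem_range hi _ hr
  obtain ⟨k, hk⟩ := hF g
  -- The lift `h` restricts to `i ∘ g` on the syzygy; subtracting an extension of `g` makes it
  -- descend to `F`.
  obtain ⟨f', hf'⟩ := LinearMap.exists_comp_eq_of_ker_le (freeCover_surjective R F)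
    (h - i ∘ₗ k) (by
      intro y hy
      obtain ⟨z, rfl⟩ := (exact_syzygyInclusion_freeCover R F y).1 hy
      have h1 := LinearMap.congr_fun hg z
      have h2 := LinearMap.congr_fun hk z
      simp only [LinearMap.comp_apply] at h1 h2
      simp [h2, h1])
  refine ⟨f', ?_⟩
  ext x
  obtain ⟨y, rfl⟩ := freeCover_surjective R F x
  have h1 := LinearMap.congr_fun hf' y
  have h2 := LinearMap.congr_fun hh y
  simp only [LinearMap.comp_apply, LinearMap.sub_apply] at h1 h2 ⊢
  rw [h1, map_sub, h2, hip.apply_apply_eq_zero, sub_zero]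

theorem ExtOneVanishes.of_exact (h₁ : ExtOneVanishes R F D) (h₂ : ExtOneVanishes R F B)
    {i : D →ₗ[R] A} {p : A →ₗ[R] B} (hi : Function.Injective i) (hip : Function.Exact i p)
    (hp : Function.Surjective p) : ExtOneVanishes R F A := by
  intro g
  obtain ⟨k, hk⟩ := h₂ (p ∘ₗ g)
  obtain ⟨h, rfl⟩ := Module.projective_lifting_property p k hp
  have hr (y : Syzygy R F) : (g - h ∘ₗ syzygyInclusion R F) y ∈ LinearMap.range i := by
    refine (hip _).1 ?_
    rw [LinearMap.sub_apply, map_sub]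
    exact sub_eq_zero.2 (LinearMap.congr_fun hk y).symm
  obtain ⟨g', hg'⟩ := LinearMap.exists_comp_eq_of_mem_range hi _ hr
  obtain ⟨k', hk'⟩ := h₁ g'
  refine ⟨h + i ∘ₗ k', ?_⟩
  rw [LinearMap.add_comp, LinearMap.comp_assoc, hk', hg']
  abel

/-- By dimension shifting, the hypothesis on the syzygy says `Ext²(F, D) = 0`. -/
theorem ExtOneVanishes.of_surjective (hA : ExtOneVanishes R F A)
    (hD : ExtOneVanishes R (Syzygy R F) D)
    {i : D →ₗ[R] A} {p : A →ₗ[R] B} (hi : Function.Injective i) (hip : Function.Exact i p)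
    (hp : Function.Surjective p) : ExtOneVanishes R F B := by
  intro g
  obtain ⟨g', rfl⟩ := hD.exists_lift hi hip hp g
  obtain ⟨h, rfl⟩ := hA g'
  exact ⟨p ∘ₗ h, rfl⟩

theorem ExtOneVanishes.of_linearEquiv (h : ExtOneVanishes R F A) (e : A ≃ₗ[R] B) :
    ExtOneVanishes R F B := by
  intro g
  obtain ⟨k, hk⟩ := h (e.symm.toLinearMap ∘ₗ g)
  refine ⟨e.toLinearMap ∘ₗ k, ?_⟩
  rw [LinearMap.comp_assoc, hk]
  ext; simp

theorem ExtOneVanishes.pi {ι : Type u} {M : ι → Type u} [∀ j, AddCommGroup (M j)]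
    [∀ j, Module R (M j)] (h : ∀ j, ExtOneVanishes R F (M j)) :
    ExtOneVanishes R F (∀ j, M j) := by
  intro g
  choose k hk using fun j => h j (LinearMap.proj j ∘ₗ g)
  refine ⟨LinearMap.pi k, ?_⟩
  ext x j
  exact LinearMap.congr_fun (hk j) x

end

/-! ### `Ext¹` into modules over an `R`-algebra -/

section

variable {R F : Type u} [CommRing R] [AddCommGroup F] [Module R F]

theorem exists_retraction_baseChange_syzygy (S : Type u) [CommRing S] [Algebra R S]
    [Module.Projective S (S ⊗[R] F)]
    (hinj : Function.Injective ((syzygyInclusion R F).lTensor S)) :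
    ∃ r : S ⊗[R] FreeCover R F →ₗ[S] S ⊗[R] Syzygy R F,
      r ∘ₗ (syzygyInclusion R F).baseChange S = LinearMap.id := by
  have hsurj : Function.Surjective ((freeCover R F).baseChange S) :=
    LinearMap.lTensor_surjective S (freeCover_surjective R F)
  have hex := lTensor_exact S (exact_syzygyInclusion_freeCover R F)
    (freeCover_surjective R F)
  obtain ⟨s, hs⟩ := Module.projective_lifting_property ((freeCover R F).baseChange S)
    LinearMap.id hsurj
  have hr (y : S ⊗[R] FreeCover R F) :
      (LinearMap.id - s ∘ₗ (freeCover R F).baseChange S :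
        S ⊗[R] FreeCover R F →ₗ[S] S ⊗[R] FreeCover R F) y ∈
        LinearMap.range ((syzygyInclusion R F).baseChange S) := by
    refine (hex _).1 ?_
    change (freeCover R F).baseChange S (y - s ((freeCover R F).baseChange S y)) = 0
    rw [map_sub, sub_eq_zero]
    exact (LinearMap.congr_fun hs _).symm
  obtain ⟨r, hr⟩ := LinearMap.exists_comp_eq_of_mem_range (R := S)
    (A := S ⊗[R] Syzygy R F) (B := S ⊗[R] FreeCover R F) hinj _ hr
  refine ⟨r, ?_⟩
  refine LinearMap.ext fun x => hinj ?_
  change (syzygyInclusion R F).baseChange S (r ((syzygyInclusion R F).baseChange S x)) =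
    (syzygyInclusion R F).baseChange S x
  refine (LinearMap.congr_fun hr _).trans ?_
  have : (freeCover R F).baseChange S ((syzygyInclusion R F).baseChange S x) = 0 :=
    (hex _).2 ⟨x, rfl⟩
  simp [this]

/-- Maps into an `S`-module factor through base change to `S`, where the presentation of `F` splits
by projectivity. -/
theorem ExtOneVanishes.of_projective_baseChange (S : Type u) [CommRing S] [Algebra R S]
    [Module.Projective S (S ⊗[R] F)]
    (hinj : Function.Injective ((syzygyInclusion R F).lTensor S))
    (X : Type u) [AddCommGroup X] [Module R X] [Module S X] [IsScalarTower R S X] :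
    ExtOneVanishes R F X := by
  intro g
  obtain ⟨r, hr⟩ := exists_retraction_baseChange_syzygy S hinj
  refine ⟨((g.liftBaseChange S ∘ₗ r).restrictScalars R) ∘ₗ TensorProduct.mk R S _ 1, ?_⟩
  ext x
  have := LinearMap.congr_fun hr (1 ⊗ₜ x)
  rw [LinearMap.comp_apply, LinearMap.baseChange_tmul] at this
  simp only [LinearMap.comp_apply, TensorProduct.mk_apply, LinearMap.restrictScalars_apply, this]
  simp

theorem flat_syzygy [Module.Flat R F] : Module.Flat R (Syzygy R F) := by
  rw [Module.Flat.iff_rTensor_injective']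
  intro I
  have h1 := LinearMap.lTensor_injective_of_exact_of_flat (freeCover R F)
    (freeCover_surjective R F) (syzygyInclusion R F) (syzygyInclusion_injective R F)
    (exact_syzygyInclusion_freeCover R F) I
  have h2 := Module.Flat.rTensor_preserves_injective_linearMap (M := FreeCover R F) I.subtype
    Subtype.val_injective
  have h3 : (I.subtype.rTensor (FreeCover R F)) ∘ₗ (syzygyInclusion R F).lTensor I =
      (syzygyInclusion R F).lTensor R ∘ₗ I.subtype.rTensor (Syzygy R F) := by
    ext; rfl
  have h4 : Function.Injective
      ((syzygyInclusion R F).lTensor R ∘ₗ I.subtype.rTensor (Syzygy R F)) := by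
    rw [← h3]
    exact h2.comp h1
  exact Function.Injective.of_comp h4

theorem syzygy_lTensor_injective [Module.Flat R F] (S : Type u) [AddCommGroup S] [Module R S] :
    Function.Injective ((syzygyInclusion R F).lTensor S) :=
  LinearMap.lTensor_injective_of_exact_of_flat (freeCover R F)
    (freeCover_surjective R F) (syzygyInclusion R F) (syzygyInclusion_injective R F)
    (exact_syzygyInclusion_freeCover R F) S

theorem projective_baseChange_syzygy [Module.Flat R F] (S : Type u) [CommRing S] [Algebra R S]
    [Module.Projective S (S ⊗[R] F)] : Module.Projective S (S ⊗[R] Syzygy R F) := by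
  obtain ⟨r, hr⟩ := exists_retraction_baseChange_syzygy (F := F) S
    (syzygy_lTensor_injective (R := R) (F := F) S)
  exact Module.Projective.of_split _ r hr

/-- A lifting problem for `S ⊗ F` over `S` is one for `F` over `R`, with obstruction in `Ext¹` of
`F` into an `S`-module, the kernel. -/
theorem projective_baseChange_of_extOneVanishes (S : Type u) [CommRing S] [Algebra R S]
    (h : ∀ (X : Type u) [AddCommGroup X] [Module R X] [Module S X] [IsScalarTower R S X],
      ExtOneVanishes R F X) : Module.Projective S (S ⊗[R] F) := by
  refine Module.Projective.of_lifting_property'' fun p hp => ?_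
  let X := LinearMap.ker p
  obtain ⟨f, hf⟩ := (h X).exists_lift (i := X.subtype.restrictScalars R)
    (p := p.restrictScalars R) Subtype.val_injective
    (fun x => ⟨fun hx => ⟨⟨x, hx⟩, rfl⟩, fun ⟨y, hy⟩ => hy ▸ y.2⟩) hp (TensorProduct.mk R S F 1)
  refine ⟨f.liftBaseChange S, ?_⟩
  ext x
  simpa using LinearMap.congr_fun hf x

theorem projective_quotient_iff (I : Ideal R) :
    Module.Projective (R ⧸ I) (F ⧸ (I • ⊤ : Submodule R F)) ↔
      Module.Projective (R ⧸ I) ((R ⧸ I) ⊗[R] F) := by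
  let e : ((R ⧸ I) ⊗[R] F) ≃ₗ[R ⧸ I] F ⧸ (I • ⊤ : Submodule R F) :=
    (TensorProduct.quotTensorEquivQuotSMul F I).extendScalarsOfSurjective
      Ideal.Quotient.mk_surjective
  exact ⟨fun _ => Module.Projective.of_equiv e.symm, fun _ => Module.Projective.of_equiv e⟩

end

/-! ### Contramodules with respect to one element -/

/-- `D` is an `s`-contramodule: every formal series `∑ sⁿ dₙ` has a well-defined sum in `D`.
Equivalently, `Ext^i(R[1/s], D) = 0` for `i = 0, 1`. -/
def IsContramodule {R D : Type*} [CommRing R] [AddCommGroup D] [Module R D] (s : R) : Prop :=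
  ∀ d : ℕ → D, ∃! x : ℕ → D, ∀ n, x n = d n + s • x (n + 1)

namespace IsContramodule

section

variable {R A B D : Type*} [CommRing R] [AddCommGroup D] [Module R D]
  [AddCommGroup A] [Module R A] [AddCommGroup B] [Module R B] {s : R}

theorem eq_zero (h : IsContramodule (D := D) s) {x : ℕ → D} (hx : ∀ n, x n = s • x (n + 1))
    (n : ℕ) : x n = 0 :=
  congrFun ((h 0).unique (y₁ := x) (y₂ := 0) (by simpa using hx) (by simp)) n

theorem of_exists_of_eq_zero (h : ∀ d : ℕ → D, ∃ x : ℕ → D, ∀ n, x n = d n + s • x (n + 1))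
    (h0 : ∀ x : ℕ → D, (∀ n, x n = s • x (n + 1)) → ∀ n, x n = 0) :
    IsContramodule (D := D) s := by
  intro d
  obtain ⟨x, hx⟩ := h d
  refine ⟨x, hx, fun y hy => funext fun n => ?_⟩
  refine sub_eq_zero.1 (h0 (fun n => y n - x n) (fun n => ?_) n)
  rw [hy n, hx n, smul_sub]
  abel

theorem of_injective (hD : IsContramodule (D := D) s) (hB : IsContramodule (D := B) s)
    {i : A →ₗ[R] D} {p : D →ₗ[R] B} (hi : Function.Injective i) (hip : Function.Exact i p) :
    IsContramodule (D := A) s := by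
  refine of_exists_of_eq_zero (fun d => ?_) (fun x hx n => hi ?_)
  · obtain ⟨x, hx, -⟩ := hD (fun n => i (d n))
    have hp (n : ℕ) : p (x n) = 0 := hB.eq_zero (x := fun n => p (x n)) (fun n => by
      rw [hx n, map_add, hip.apply_apply_eq_zero, zero_add, map_smul]) n
    choose y hy using fun n => (hip (x n)).1 (hp n)
    refine ⟨y, fun n => hi ?_⟩
    rw [map_add, map_smul, hy, hy, hx n]
  · rw [map_zero]
    exact hD.eq_zero (x := fun n => i (x n)) (fun n => by rw [hx n, map_smul]) n

/-- Sums in `B` are images of sums of lifts. For uniqueness, lifts of a solution of the homogeneous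
recursion satisfy it up to errors in `A`, and summing the errors in `A` corrects the lifts. -/
theorem of_surjective (hA : IsContramodule (D := A) s) (hD : IsContramodule (D := D) s)
    {i : A →ₗ[R] D} {p : D →ₗ[R] B} (hip : Function.Exact i p) (hp : Function.Surjective p) :
    IsContramodule (D := B) s := by
  refine of_exists_of_eq_zero (fun d => ?_) (fun z hz n => ?_)
  · choose e he using fun n => hp (d n)
    obtain ⟨x, hx, -⟩ := hD e
    exact ⟨fun n => p (x n), fun n => by dsimp only; rw [hx n, map_add, map_smul, he]⟩
  · choose b hb using fun n => hp (z n)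
    have hb' (n : ℕ) : p (b n - s • b (n + 1)) = 0 := by
      rw [map_sub, map_smul, hb, hb, ← hz, sub_self]
    choose a ha using fun n => (hip _).1 (hb' n)
    obtain ⟨y, hy, -⟩ := hA a
    have := hD.eq_zero (x := fun n => b n - i (y n)) (fun n => by
      rw [hy n, map_add, map_smul, ha, smul_sub]; abel) n
    rw [← hb, sub_eq_zero.1 this, hip.apply_apply_eq_zero]

theorem of_linearEquiv (hA : IsContramodule (D := A) s) (e : A ≃ₗ[R] B) :
    IsContramodule (D := B) s := by
  refine of_exists_of_eq_zero (fun d => ?_) (fun z hz n => ?_)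
  · obtain ⟨x, hx, -⟩ := hA (fun n => e.symm (d n))
    exact ⟨fun n => e (x n), fun n => by dsimp only; rw [hx n]; simp⟩
  · have := hA.eq_zero (x := fun n => e.symm (z n)) (fun n => by rw [hz n]; simp) n
    simpa using this

theorem ker (hA : IsContramodule (D := A) s) (hB : IsContramodule (D := B) s)
    (f : A →ₗ[R] B) : IsContramodule (D := LinearMap.ker f) s :=
  hA.of_injective hB (Submodule.subtype_injective _) (LinearMap.exact_subtype_ker_map f)

theorem range (hA : IsContramodule (D := A) s) (hB : IsContramodule (D := B) s)
    (f : A →ₗ[R] B) : IsContramodule (D := LinearMap.range f) s :=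
  (hA.ker hB f).of_surjective hA (p := f.rangeRestrict) (i := (LinearMap.ker f).subtype)
    (by rw [LinearMap.exact_iff]; simp) f.surjective_rangeRestrict

theorem quotient_range (hA : IsContramodule (D := A) s) (hB : IsContramodule (D := B) s)
    (f : A →ₗ[R] B) : IsContramodule (D := B ⧸ LinearMap.range f) s :=
  hA.of_surjective hB (i := f) (p := (LinearMap.range f).mkQ)
    (LinearMap.exact_map_mkQ_range f) (Submodule.mkQ_surjective _)

theorem pi {ι : Type*} {M : ι → Type*} [∀ j, AddCommGroup (M j)] [∀ j, Module R (M j)]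
    (h : ∀ j, IsContramodule (D := M j) s) : IsContramodule (D := ∀ j, M j) s := by
  refine of_exists_of_eq_zero (fun d => ?_) (fun z hz n => ?_)
  · choose x hx _ using fun j => h j (fun n => d n j)
    exact ⟨fun n j => x j n, fun n => funext fun j => hx j n⟩
  · exact funext fun j => (h j).eq_zero (x := fun n => z n j) (fun n => congrFun (hz n) j) n

/-- Sums are taken pointwise; their uniqueness makes the result linear. -/
theorem linearMap (hD : IsContramodule (D := D) s) : IsContramodule (D := A →ₗ[R] D) s := by
  refine of_exists_of_eq_zero (fun d => ?_) (fun z hz n => ?_)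
  · choose x hx hx' using fun a => hD (fun n => d n a)
    refine ⟨fun n => { toFun := fun a => x a n, map_add' := ?_, map_smul' := ?_ },
      fun n => LinearMap.ext fun a => hx a n⟩
    · intro a b
      refine (congrFun (hx' (a + b) (fun n => x a n + x b n) fun n => ?_) n).symm
      simp only [hx a n, hx b n, map_add, smul_add]
      abel
    · intro r a
      refine (congrFun (hx' (r • a) (fun n => r • x a n) fun n => ?_) n).symm
      simp only [hx a n, map_smul, smul_add, smul_comm s r]
  · exact LinearMap.ext fun a =>
      hD.eq_zero (x := fun n => z n a) (fun n => LinearMap.congr_fun (hz n) a) n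

theorem subsingleton (hD : IsContramodule (D := D) s) (h : ∀ x : D, ∃ y, x = s • y) :
    ∀ x : D, x = 0 := by
  choose f hf using h
  intro x
  exact hD.eq_zero (x := fun n => f^[n] x)
    (fun n => by rw [Function.iterate_succ_apply']; exact hf _) 0

theorem exists_sub_smul_eq (hD : IsContramodule (D := D) s) (x : D) :
    ∃ y : D, x = y - s • y := by
  obtain ⟨y, hy, hy'⟩ := hD (fun _ => x)
  -- The shift of a solution for a constant series solves the same series, so the solution is
  -- constant, giving `y = x + s • y`.
  have := congrFun (hy' (fun n => y (n + 1)) (fun n => hy (n + 1))) 0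
  have h0 := hy 0
  rw [show y (0 + 1) = y 0 from this] at h0
  exact ⟨y 0, eq_sub_of_add_eq h0.symm⟩

/-- A submodule of a contramodule is a contramodule iff it is closed under infinite sums. -/
theorem submodule_iff (hD : IsContramodule (D := D) s) (M : Submodule R D) :
    IsContramodule (D := M) s ↔
      ∀ d x : ℕ → D, (∀ n, x n = d n + s • x (n + 1)) → (∀ n, d n ∈ M) → ∀ n, x n ∈ M := by
  constructor
  · intro hM d x hx hd n
    obtain ⟨y, hy, -⟩ := hM (fun n => ⟨d n, hd n⟩)
    have : x = fun n => (y n : D) :=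
      (hD d).unique hx (fun n => congrArg Subtype.val (hy n))
    rw [this]
    exact (y n).2
  · intro h
    refine of_exists_of_eq_zero (fun d => ?_) (fun z hz n => Subtype.ext ?_)
    · obtain ⟨x, hx, -⟩ := hD (fun n => d n)
      exact ⟨fun n => ⟨x n, h _ x hx (fun n => (d n).2) n⟩, fun n => Subtype.ext (hx n)⟩
    · exact hD.eq_zero (x := fun n => (z n : D)) (fun n => congrArg Subtype.val (hz n)) n

theorem sInf (hD : IsContramodule (D := D) s) {T : Set (Submodule R D)}
    (hT : ∀ M ∈ T, IsContramodule (D := M) s) :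
    IsContramodule (D := (sInf T : Submodule R D)) s := by
  rw [hD.submodule_iff]
  intro d x hx hd n
  rw [Submodule.mem_sInf]
  intro M hM
  exact (hD.submodule_iff M).1 (hT M hM) d x hx
    (fun n => (Submodule.mem_sInf.1 (hd n)) M hM) n

/-- If `s` acts locally nilpotently on `N`, then `Hom(N, X)` is an `s`-contramodule. -/
theorem linearMap_of_nilpotent (h : ∀ a : A, ∃ n : ℕ, s ^ n • a = 0) :
    IsContramodule (D := A →ₗ[R] D) s := by
  have hpow {a : A} {m n : ℕ} (hm : s ^ m • a = 0) (hmn : m ≤ n) : s ^ n • a = 0 := by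
    rw [← Nat.sub_add_cancel hmn, pow_add, mul_smul, hm, smul_zero]
  refine of_exists_of_eq_zero (fun d => ?_) (fun z hz n => LinearMap.ext fun a => ?_)
  · choose m hm using h
    -- The sum is the same for every exponent that kills `a`, so different elements can share a
    -- common bound.
    have key (n : ℕ) (a : A) (k : ℕ) (hk : s ^ k • a = 0) :
        ∑ j ∈ Finset.range k, d (n + j) (s ^ j • a) =
          ∑ j ∈ Finset.range (m a), d (n + j) (s ^ j • a) := by
      wlog hkm : k ≤ m a generalizing k
      · refine (Finset.sum_subset (Finset.range_mono (le_of_not_ge hkm)) ?_).symm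
        intro j _ hj
        rw [hpow (hm a) (by simpa using hj), map_zero]
      · refine Finset.sum_subset (Finset.range_mono hkm) ?_
        intro j _ hj
        rw [hpow hk (by simpa using hj), map_zero]
    refine ⟨fun n =>
      { toFun := fun a => ∑ j ∈ Finset.range (m a), d (n + j) (s ^ j • a)
        map_add' := ?_, map_smul' := ?_ }, fun n => LinearMap.ext fun a => ?_⟩
    · intro a b
      have ha := hpow (hm a) (le_max_left (m a) (m b))
      have hb := hpow (hm b) (le_max_right (m a) (m b))
      rw [← key n (a + b) (max (m a) (m b)) (by rw [smul_add, ha, hb, add_zero]),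
        ← key n a _ ha, ← key n b _ hb, ← Finset.sum_add_distrib]
      simp
    · intro r a
      have ha : s ^ m a • r • a = 0 := by rw [smul_comm, hm, smul_zero]
      rw [← key n _ _ ha, RingHom.id_apply, Finset.smul_sum]
      refine Finset.sum_congr rfl fun j _ => ?_
      rw [smul_comm, map_smul]
    · have ha := hpow (hm a) (Nat.le_succ _)
      simp only [LinearMap.coe_mk, AddHom.coe_mk, LinearMap.add_apply, LinearMap.smul_apply]
      rw [← key n _ _ ha, Finset.sum_range_succ', Finset.smul_sum, add_comm]
      simp only [add_zero, pow_zero, one_smul, add_right_inj]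
      refine Finset.sum_congr rfl fun j _ => ?_
      rw [← map_smul, smul_smul, ← pow_succ', add_assoc, add_comm 1 j]
  · obtain ⟨m, hm⟩ := h a
    have (k : ℕ) : z n a = z (n + k) (s ^ k • a) := by
      induction k with
      | zero => simp
      | succ k ih =>
        rw [ih, hz (n + k), LinearMap.smul_apply, ← map_smul, smul_smul, ← pow_succ', add_assoc]
    rw [this m, hm, map_zero, LinearMap.zero_apply]

end

end IsContramodule

/-! ### Nakayama and `Ext¹` vanishing for several generators -/

section

variable {R : Type u} [CommRing R]

theorem sup_span_cons (I : Ideal R) (s : R) (l : List R) :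
    I ⊔ Ideal.span {x | x ∈ s :: l} = (I ⊔ Ideal.span {s}) ⊔ Ideal.span {x | x ∈ l} := by
  have : {x | x ∈ s :: l} = {s} ∪ {x | x ∈ l} := by ext; simp
  rw [this, Ideal.span_union, sup_assoc]

theorem smul_eq_zero_of_mem_sup_span_singleton {D : Type*} [AddCommGroup D] [Module R D]
    {I : Ideal R} {s : R} (hI : ∀ a ∈ I, ∀ x : D, a • x = 0) (hs : ∀ x : D, s • x = 0) :
    ∀ a ∈ I ⊔ Ideal.span {s}, ∀ x : D, a • x = 0 := by
  intro a ha x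
  obtain ⟨b, hb, c, hc, rfl⟩ := Submodule.mem_sup.1 ha
  obtain ⟨t, rfl⟩ := Ideal.mem_span_singleton'.1 hc
  rw [add_smul, hI b hb, mul_smul, hs, smul_zero, add_zero]

/-- A Nakayama lemma: there are no nonzero maps from a module `N` with `JN = N` to a module which
is a contramodule with respect to generators of `J`. -/
theorem linearMap_eq_zero_of_le_smul_top (l : List R) (I : Ideal R)
    {N D : Type u} [AddCommGroup N] [Module R N] [AddCommGroup D] [Module R D]
    (hI : ∀ a ∈ I, ∀ x : D, a • x = 0) (hD : ∀ s ∈ l, IsContramodule (D := D) s)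
    (hN : (⊤ : Submodule R N) ≤ (I ⊔ Ideal.span {x | x ∈ l}) • ⊤) (f : N →ₗ[R] D) : f = 0 := by
  induction l generalizing I D with
  | nil =>
    ext n
    have hn := hN (Submodule.mem_top (x := n))
    have hIe : I ⊔ Ideal.span {x | x ∈ ([] : List R)} = I := by simp
    rw [hIe] at hn
    induction hn using Submodule.smul_induction_on' with
    | smul a ha x _ => rw [map_smul, hI a ha]; rfl
    | add x _ y _ hx hy => rw [map_add, hx, hy]; simp
  | cons s l ih =>
    -- `M` will be the least submodule containing the image of `f` that is a contramodule for all
    -- generators. By induction `f` vanishes modulo `s • M`, so `s • M` also qualifies and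
    -- minimality gives `M = s • M`; a contramodule with this property is zero.
    let T : Set (Submodule R D) :=
      {M | LinearMap.range f ≤ M ∧ ∀ t ∈ s :: l, IsContramodule (D := M) t}
    let M : Submodule R D := sInf T
    have hM : ∀ t ∈ s :: l, IsContramodule (D := M) t := fun t ht =>
      (hD t ht).sInf fun M' hM' => hM'.2 t ht
    have hfM (n : N) : f n ∈ M := Submodule.mem_sInf.2 fun M' hM' => hM'.1 ⟨n, rfl⟩
    let φ : M →ₗ[R] M := LinearMap.lsmul R M s
    have hq : (LinearMap.range φ).mkQ ∘ₗ f.codRestrict M hfM = 0 := by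
      refine ih (I ⊔ Ideal.span {s}) ?_ ?_ ?_ _
      · refine smul_eq_zero_of_mem_sup_span_singleton ?_ ?_
        · intro a ha x
          obtain ⟨x, rfl⟩ := Submodule.mkQ_surjective _ x
          rw [← map_smul, show a • x = 0 from Subtype.ext (hI a ha x), map_zero]
        · intro x
          obtain ⟨x, rfl⟩ := Submodule.mkQ_surjective _ x
          rw [← map_smul]
          exact (Submodule.Quotient.mk_eq_zero _).2 ⟨x, rfl⟩
      · intro t ht
        exact (hM t (List.mem_cons_of_mem _ ht)).quotient_range
          (hM t (List.mem_cons_of_mem _ ht)) φ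
      · rwa [← sup_span_cons]
    let M' : Submodule R D := (LinearMap.range φ).map M.subtype
    have hM' : M' ∈ T := by
      constructor
      · rintro _ ⟨n, rfl⟩
        have := LinearMap.congr_fun hq n
        exact ⟨_, (Submodule.Quotient.mk_eq_zero _).1 this, rfl⟩
      · intro t ht
        exact ((hM t ht).range (hM t ht) φ).of_linearEquiv
          ((LinearMap.range φ).equivMapOfInjective M.subtype (Submodule.subtype_injective _))
    have hle : M ≤ M' := sInf_le hM'
    have h0 := (hM s List.mem_cons_self).subsingleton fun x => by
      obtain ⟨_, ⟨y, rfl⟩, hy⟩ := hle x.2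
      exact ⟨y, Subtype.ext hy.symm⟩
    ext n
    exact congrArg Subtype.val (h0 ⟨f n, hfM n⟩)

/-- If `F` is flat and `F/JF` is projective over `R/J`, then `Ext¹(F, D) = 0` whenever `D` is a
contramodule with respect to generators of `J`. -/
theorem extOneVanishes_of_isContramodule (J : Ideal R) (l : List R) (I : Ideal R)
    (hJ : I ⊔ Ideal.span {x | x ∈ l} = J) (F : Type u) [AddCommGroup F] [Module R F]
    [Module.Flat R F] [Module.Projective (R ⧸ J) ((R ⧸ J) ⊗[R] F)]
    (D : Type u) [AddCommGroup D] [Module R D]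
    (hI : ∀ a ∈ I, ∀ x : D, a • x = 0) (hD : ∀ s ∈ l, IsContramodule (D := D) s) :
    ExtOneVanishes R F D := by
  induction l generalizing I F D with
  | nil =>
    have hIJ : I = J := by simpa using hJ
    subst hIJ
    have ht : Module.IsTorsionBySet R D I := fun x a => hI a a.2 x
    let _ : Module (R ⧸ I) D := ht.module
    have : IsScalarTower R (R ⧸ I) D := ht.isScalarTower
    exact ExtOneVanishes.of_projective_baseChange (R ⧸ I) (syzygy_lTensor_injective (F := F) _) D
  | cons s l ih =>
    rw [sup_span_cons] at hJ
    let φ : D →ₗ[R] D := LinearMap.lsmul R D s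
    have hl (t) (ht : t ∈ l) : IsContramodule (D := D) t := hD t (List.mem_cons_of_mem _ ht)
    have hcoker (F : Type u) [AddCommGroup F] [Module R F] [Module.Flat R F]
        [Module.Projective (R ⧸ J) ((R ⧸ J) ⊗[R] F)] :
        ExtOneVanishes R F (D ⧸ LinearMap.range φ) := by
      refine ih _ hJ F _ (smul_eq_zero_of_mem_sup_span_singleton ?_ ?_)
        fun t ht => (hl t ht).quotient_range (hl t ht) φ
      · intro a ha x
        obtain ⟨x, rfl⟩ := Submodule.mkQ_surjective _ x
        rw [← map_smul, hI a ha, map_zero]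
      · intro x
        obtain ⟨x, rfl⟩ := Submodule.mkQ_surjective _ x
        rw [← map_smul]
        exact (Submodule.Quotient.mk_eq_zero _).2 ⟨x, rfl⟩
    have hker (F : Type u) [AddCommGroup F] [Module R F] [Module.Flat R F]
        [Module.Projective (R ⧸ J) ((R ⧸ J) ⊗[R] F)] :
        ExtOneVanishes R F (LinearMap.ker φ) := by
      refine ih _ hJ F _ (smul_eq_zero_of_mem_sup_span_singleton ?_ ?_)
        fun t ht => (hl t ht).ker (hl t ht) φ
      · exact fun a ha x => Subtype.ext (hI a ha x)
      · exact fun x => Subtype.ext x.2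
    have := flat_syzygy (R := R) (F := F)
    have : Module.Projective (R ⧸ J) ((R ⧸ J) ⊗[R] Syzygy R F) :=
      projective_baseChange_syzygy _
    -- The kernel and cokernel of `s` on `D` are killed by `s`, so induction applies to them. The
    -- cokernel lets `g` be extended modulo `s • D`; the kernel, with the syzygy in place of `F`,
    -- lets the remainder be divided by `s`.
    have step (g : Syzygy R F →ₗ[R] D) : ∃ g' : Syzygy R F →ₗ[R] D,
        ∃ h : FreeCover R F →ₗ[R] D, g = h ∘ₗ syzygyInclusion R F + s • g' := by
      obtain ⟨k, hk⟩ := hcoker F ((LinearMap.range φ).mkQ ∘ₗ g)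
      obtain ⟨h, rfl⟩ := Module.projective_lifting_property _ k
        (Submodule.mkQ_surjective (LinearMap.range φ))
      have hr (y : Syzygy R F) :
          (g - h ∘ₗ syzygyInclusion R F) y ∈ LinearMap.range φ := by
        have := LinearMap.congr_fun hk y
        exact (Submodule.Quotient.eq _).1 this.symm
      obtain ⟨g', hg'⟩ := (hker (Syzygy R F)).exists_lift (i := (LinearMap.ker φ).subtype)
        (p := φ.rangeRestrict) (Submodule.subtype_injective _)
        (by rw [LinearMap.exact_iff]; simp) φ.surjective_rangeRestrict
        ((g - h ∘ₗ syzygyInclusion R F).codRestrict _ hr)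
      refine ⟨g', h, LinearMap.ext fun y => ?_⟩
      have := congrArg Subtype.val (LinearMap.congr_fun hg' y)
      change s • g' y = g y - h (syzygyInclusion R F y) at this
      simp [this]
    choose next h hnext using step
    intro g
    let gs : ℕ → Syzygy R F →ₗ[R] D := fun n => next^[n] g
    have hgs (n : ℕ) : gs n = h (gs n) ∘ₗ syzygyInclusion R F + s • gs (n + 1) := by
      have : gs (n + 1) = next (gs n) := Function.iterate_succ_apply' _ _ _
      rw [this]
      exact hnext _
    have hs := hD s List.mem_cons_self
    obtain ⟨x, hx, -⟩ := hs.linearMap (A := FreeCover R F) fun n => h (gs n)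
    refine ⟨x 0, ?_⟩
    -- Iterating `step` writes `g` as a formal series of restrictions. The series of extensions sums
    -- on the free cover, and uniqueness of sums on the syzygy shows that it restricts to `g`.
    have := (hs.linearMap (A := Syzygy R F) fun n => h (gs n) ∘ₗ syzygyInclusion R F).unique
      (y₁ := fun n => x n ∘ₗ syzygyInclusion R F) (y₂ := gs) (fun n => by
        rw [hx n]; rfl) hgs
    exact congrFun this 0

end

/-! ### The Gabriel filter and local decomposition of torsion modules -/

section

variable {R U : Type u} [CommRing R] [CommRing U] [Algebra R U]

theorem mem_gabrielFilter_iff {I : Ideal R} :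
    I ∈ gabrielFilter R U ↔ I.map (algebraMap R U) = ⊤ := by
  have e := TensorProduct.quotTensorEquivQuotSMul U I
  change Subsingleton ((R ⧸ I) ⊗[R] U) ↔ _
  rw [e.toEquiv.subsingleton_congr, Submodule.Quotient.subsingleton_iff,
    Ideal.smul_top_eq_map, Submodule.restrictScalars_eq_top_iff]

theorem gabrielFilter_mono {I J : Ideal R} (hI : I ∈ gabrielFilter R U) (h : I ≤ J) :
    J ∈ gabrielFilter R U := by
  rw [mem_gabrielFilter_iff] at hI ⊢
  exact top_le_iff.1 (hI ▸ Ideal.map_mono h)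

theorem exists_fg_le_of_mem_gabrielFilter {I : Ideal R} (hI : I ∈ gabrielFilter R U) :
    ∃ J ≤ I, J.FG ∧ J ∈ gabrielFilter R U := by
  rw [mem_gabrielFilter_iff] at hI
  have h1 : (1 : U) ∈ Submodule.span U (algebraMap R U '' I) :=
    (Ideal.eq_top_iff_one _).1 hI
  obtain ⟨T, hT, h1T⟩ := Submodule.mem_span_finite_of_mem_span h1
  classical
  obtain ⟨T', hT', rfl⟩ := Finset.subset_set_image_iff.1 hT
  refine ⟨Ideal.span T', Ideal.span_le.2 hT', ⟨T', rfl⟩, ?_⟩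
  rw [mem_gabrielFilter_iff, Ideal.eq_top_iff_one, Ideal.map_span]
  simpa using h1T

variable (R U) in
/-- The maximal ideals in the Gabriel filter. -/
abbrev GabrielMaximal : Type u :=
  {m : MaximalSpectrum R // m.asIdeal ∈ gabrielFilter R U}

theorem isMaximal_of_mem_gabrielFilter_of_isPrime
    (hG : ∀ I ∈ gabrielFilter R U, IsSemilocalOfDimZero (R ⧸ I)) {P : Ideal R} (hP : P.IsPrime)
    (hPG : P ∈ gabrielFilter R U) : P.IsMaximal := by
  have h0 := Ring.krullDimLE_zero_iff.1 (hG P hPG).2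
  have : (⊥ : Ideal (R ⧸ P)).IsPrime := Ideal.isPrime_bot
  rw [← Ideal.bot_quotient_isMaximal_iff]
  exact h0 _ this

/-- Primes above `I` lie in the filter and so are maximal; hence the radical of `I` is the
intersection of the maximal ideals above it. -/
theorem exists_pow_mem_of_mem_gabrielFilter
    (hG : ∀ I ∈ gabrielFilter R U, IsSemilocalOfDimZero (R ⧸ I)) {I : Ideal R}
    (hI : I ∈ gabrielFilter R U) {a : R} (ha : ∀ M : Ideal R, M.IsMaximal → I ≤ M → a ∈ M) :
    ∃ n : ℕ, a ^ n ∈ I := by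
  have : a ∈ I.radical := by
    rw [Ideal.radical_eq_sInf, Submodule.mem_sInf]
    rintro P ⟨hIP, hP⟩
    exact ha P (isMaximal_of_mem_gabrielFilter_of_isPrime hG hP (gabrielFilter_mono hI hIP)) hIP
  exact this

theorem finite_isMaximal_of_mem_gabrielFilter
    (hG : ∀ I ∈ gabrielFilter R U, IsSemilocalOfDimZero (R ⧸ I)) {I : Ideal R}
    (hI : I ∈ gabrielFilter R U) : {M : Ideal R | M.IsMaximal ∧ I ≤ M}.Finite := by
  have := (hG I hI).1
  refine (Set.finite_range fun p : MaximalSpectrum (R ⧸ I) =>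
    p.asIdeal.comap (Ideal.Quotient.mk I)).subset ?_
  rintro M ⟨hM, hIM⟩
  have hcomap : (M.map (Ideal.Quotient.mk I)).comap (Ideal.Quotient.mk I) = M := by
    rw [Ideal.comap_map_of_surjective _ Ideal.Quotient.mk_surjective, ← RingHom.ker_eq_comap_bot,
      Ideal.mk_ker, sup_eq_left.2 hIM]
  rcases Ideal.map_eq_top_or_isMaximal_of_surjective (Ideal.Quotient.mk I)
    Ideal.Quotient.mk_surjective hM with h | h
  · rw [h, Ideal.comap_top] at hcomap
    exact absurd hcomap.symm hM.ne_top
  · exact ⟨⟨_, h⟩, hcomap⟩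

/-- Prime avoidance. -/
theorem exists_mem_forall_notMem_of_isMaximal {m : Ideal R} (hm : m.IsMaximal)
    (S : Finset (Ideal R)) (hS : ∀ M ∈ S, M.IsMaximal ∧ M ≠ m) : ∃ b ∈ m, ∀ M ∈ S, b ∉ M := by
  by_contra! h
  have hsub : (m : Set R) ⊆ ⋃ M ∈ (S : Set (Ideal R)), ((id M : Ideal R) : Set R) := by
    intro b hb
    obtain ⟨M, hM, hbM⟩ := h b hb
    exact Set.mem_biUnion hM hbM
  obtain ⟨M, hM, hle⟩ := (Ideal.subset_union_prime (f := id) ⊥ ⊥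
    fun M hM _ _ => (hS M hM).1.isPrime).1 hsub
  exact (hS M hM).2 (hm.eq_of_le (hS M hM).1.ne_top hle).symm

/-- A maximal ideal in the Gabriel filter contains a finitely generated ideal in the filter which
is contained in no other maximal ideal. -/
theorem exists_generators_of_gabrielMaximal
    (hG : ∀ I ∈ gabrielFilter R U, IsSemilocalOfDimZero (R ⧸ I)) (m : GabrielMaximal R U) :
    ∃ (n : ℕ) (v : Fin n → R), (∀ i, v i ∈ m.1.asIdeal) ∧
      Ideal.span (Set.range v) ∈ gabrielFilter R U ∧
      ∀ M : Ideal R, M.IsMaximal → Ideal.span (Set.range v) ≤ M → M = m.1.asIdeal := by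
  obtain ⟨J, hJm, hJ, hJG⟩ := exists_fg_le_of_mem_gabrielFilter m.2
  -- The finitely many unwanted maximal ideals above `J`; adjoining one `b` in `m` that avoids them
  -- all excludes them.
  let S := (finite_isMaximal_of_mem_gabrielFilter hG hJG).toFinset.filter (· ≠ m.1.asIdeal)
  have hS {M : Ideal R} : M ∈ S ↔ (M.IsMaximal ∧ J ≤ M) ∧ M ≠ m.1.asIdeal := by simp [S]
  obtain ⟨b, hbm, hbS⟩ := exists_mem_forall_notMem_of_isMaximal m.1.isMaximal S
    fun M hM => ⟨(hS.1 hM).1.1, (hS.1 hM).2⟩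
  have hJb : (J ⊔ Ideal.span {b}).FG := Submodule.FG.sup hJ (Submodule.fg_span_singleton b)
  obtain ⟨n, v, hv⟩ := Submodule.fg_iff_exists_fin_generating_family.1 hJb
  have hv' : Ideal.span (Set.range v) = J ⊔ Ideal.span {b} := hv
  have hle : J ⊔ Ideal.span {b} ≤ m.1.asIdeal :=
    sup_le hJm ((Ideal.span_singleton_le_iff_mem _).2 hbm)
  refine ⟨n, v, fun i => hle (hv' ▸ Ideal.subset_span ⟨i, rfl⟩), ?_, fun M hM hvM => ?_⟩
  · exact hv' ▸ gabrielFilter_mono hJG le_sup_left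
  · by_contra hne
    rw [hv'] at hvM
    exact hbS M (hS.2 ⟨⟨hM, le_sup_left.trans hvM⟩, hne⟩)
      (hvM (Ideal.mem_sup_right (Ideal.mem_span_singleton_self b)))

section Torsion

variable {N : Type u} [AddCommGroup N] [Module R N]

theorem torsionOf_le_torsionOf_smul (r : R) (x : N) :
    Ideal.torsionOf R N x ≤ Ideal.torsionOf R N (r • x) := by
  intro a ha
  rw [Ideal.mem_torsionOf_iff] at ha ⊢
  rw [smul_comm, ha, smul_zero]

variable (N) in
/-- The elements of `N` whose annihilator is contained in no maximal ideal besides `m`. -/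
def localPart (m : Ideal R) : Submodule R N where
  carrier := {x | ∀ M : Ideal R, M.IsMaximal → Ideal.torsionOf R N x ≤ M → M = m}
  zero_mem' M hM h := by
    rw [Ideal.torsionOf_zero, top_le_iff] at h
    exact absurd h hM.ne_top
  add_mem' {x y} hx hy M hM h := by
    have : Ideal.torsionOf R N x * Ideal.torsionOf R N y ≤ M := by
      refine le_trans (Ideal.mul_le.2 fun a ha b hb => ?_) h
      rw [Ideal.mem_torsionOf_iff] at ha hb ⊢
      rw [smul_add, mul_smul, mul_smul, hb, smul_zero, add_zero, smul_comm, ha, smul_zero]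
    rcases hM.isPrime.mul_le.1 this with h | h
    · exact hx M hM h
    · exact hy M hM h
  smul_mem' r x hx M hM h := hx M hM ((torsionOf_le_torsionOf_smul r x).trans h)

variable (N) in
/-- The elements of `N` that vanish in the localization at the prime ideal `m`. -/
def awayPart (m : Ideal R) [hm : m.IsPrime] : Submodule R N where
  carrier := {x | ∃ a ∉ m, a • x = 0}
  zero_mem' := ⟨1, m.one_notMem, smul_zero _⟩
  add_mem' := by
    rintro x y ⟨a, ha, hax⟩ ⟨b, hb, hby⟩
    refine ⟨a * b, hm.mul_notMem ha hb, ?_⟩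
    rw [smul_add, mul_smul, mul_smul, hby, smul_zero, add_zero, smul_comm, hax, smul_zero]
  smul_mem' := by
    rintro r x ⟨a, ha, hax⟩
    exact ⟨a, ha, by rw [smul_comm, hax, smul_zero]⟩

theorem localPart_le_awayPart {m m' : Ideal R} [hm' : m'.IsMaximal] (h : m' ≠ m) :
    localPart N m ≤ awayPart N m' := by
  intro x hx
  obtain ⟨a, ha, ha'⟩ := SetLike.not_le_iff_exists.1 fun hle => h (hx m' hm' hle)
  exact ⟨a, ha', (Ideal.mem_torsionOf_iff _ _).1 ha⟩

theorem eq_zero_of_mem_localPart_of_mem_awayPart {m : Ideal R} [m.IsMaximal] {x : N}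
    (h : x ∈ localPart N m) (h' : x ∈ awayPart N m) : x = 0 := by
  by_contra hx
  have hne : Ideal.torsionOf R N x ≠ ⊤ := by rwa [Ne, Ideal.torsionOf_eq_top_iff]
  obtain ⟨M, hM, hle⟩ := Ideal.exists_le_maximal _ hne
  obtain ⟨a, ha, hax⟩ := h'
  exact ha (h M hM hle ▸ hle ((Ideal.mem_torsionOf_iff _ _).2 hax))

variable (U) in
/-- A module is `𝔾`-torsion if the annihilators of its elements belong to the Gabriel filter. -/
def IsGabrielTorsion (N : Type u) [AddCommGroup N] [Module R N] : Prop :=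
  ∀ x : N, Ideal.torsionOf R N x ∈ gabrielFilter R U

/-- Independence: the local parts at other ideals vanish in the localization at `m`, while the part
at `m` meets that kernel trivially. Generation: were `x` outside the sum `W`, some maximal `m` would
contain `W.colon {x}`, yet a power of an element outside `m` carries `x` into the local part at `m`.
-/
theorem isInternal_localPart
    (hG : ∀ I ∈ gabrielFilter R U, IsSemilocalOfDimZero (R ⧸ I))
    (hN : IsGabrielTorsion (R := R) U N)
    [DecidableEq (GabrielMaximal R U)] :
    DirectSum.IsInternal fun m : GabrielMaximal R U => localPart N m.1.asIdeal := by
  rw [DirectSum.isInternal_submodule_iff_iSupIndep_and_iSup_eq_top]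
  constructor
  · rw [iSupIndep_def]
    intro m
    have := m.1.isMaximal
    rw [Submodule.disjoint_def]
    intro x hx hx'
    refine eq_zero_of_mem_localPart_of_mem_awayPart hx ?_
    refine (iSup₂_le fun j hj => localPart_le_awayPart fun h => hj ?_ :
      (⨆ j, ⨆ (_ : j ≠ m), localPart N j.1.asIdeal) ≤ awayPart N m.1.asIdeal) hx'
    exact Subtype.ext (MaximalSpectrum.ext h.symm)
  · rw [eq_top_iff]
    intro x _
    set W := ⨆ m : GabrielMaximal R U, localPart N m.1.asIdeal
    by_contra hxW
    have hne : W.colon {x} ≠ ⊤ := by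
      intro h
      have h1 : (1 : R) ∈ W.colon {x} := h ▸ Submodule.mem_top
      rw [Submodule.mem_colon_singleton, one_smul] at h1
      exact hxW h1
    obtain ⟨m, hm, hle⟩ := Ideal.exists_le_maximal _ hne
    have htors : Ideal.torsionOf R N x ≤ m := fun a ha => hle (by
      rw [Submodule.mem_colon_singleton, (Ideal.mem_torsionOf_iff _ _).1 ha]
      exact W.zero_mem)
    let S := (finite_isMaximal_of_mem_gabrielFilter hG (hN x)).toFinset.filter (· ≠ m)
    have hS {M : Ideal R} : M ∈ S ↔ (M.IsMaximal ∧ Ideal.torsionOf R N x ≤ M) ∧ M ≠ m := by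
      simp [S]
    -- `a` lies in every other maximal ideal above the annihilator of `x`, and `b` below lies in `m`
    -- but in none of those. Thus `a * b` is nilpotent modulo the annihilator, and `a ^ n • x` is
    -- killed by `b ^ n`, which excludes every maximal ideal but `m`.
    obtain ⟨a, haS, ham⟩ : ∃ a ∈ S.inf id, a ∉ m := by
      refine SetLike.not_le_iff_exists.1 fun h => ?_
      obtain ⟨M, hM, hMm⟩ := (hm.isPrime.inf_le' (f := id)).1 h
      exact (hS.1 hM).2 ((hS.1 hM).1.1.eq_of_le hm.ne_top hMm)
    obtain ⟨b, hbm, hbS⟩ := exists_mem_forall_notMem_of_isMaximal hm S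
      fun M hM => ⟨(hS.1 hM).1.1, (hS.1 hM).2⟩
    obtain ⟨n, hn⟩ := exists_pow_mem_of_mem_gabrielFilter hG (hN x) (a := a * b) (by
      intro M hM hxM
      by_cases h : M = m
      · exact h ▸ m.mul_mem_left a hbm
      · exact M.mul_mem_right b ((Finset.inf_le (hS.2 ⟨⟨hM, hxM⟩, h⟩) :
          S.inf id ≤ M) haS))
    have hax : a ^ n • x ∈ localPart N m := by
      intro M hM h
      by_contra hMm
      have hxM := (torsionOf_le_torsionOf_smul (a ^ n) x).trans h
      refine hbS M (hS.2 ⟨⟨hM, hxM⟩, hMm⟩) (hM.isPrime.mem_of_pow_mem n (h ?_))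
      rw [Ideal.mem_torsionOf_iff, smul_smul, ← mul_pow, mul_comm b a]
      exact (Ideal.mem_torsionOf_iff _ _).1 hn
    have haW : a ^ n ∈ W.colon {x} := by
      rw [Submodule.mem_colon_singleton]
      exact (le_iSup (fun m : GabrielMaximal R U => localPart N m.1.asIdeal)
        ⟨⟨m, hm⟩, gabrielFilter_mono (hN x) htors⟩ :) hax
    exact ham (hm.isPrime.mem_of_pow_mem n (hle haW))

theorem exists_pow_smul_eq_zero_of_mem_localPart
    (hG : ∀ I ∈ gabrielFilter R U, IsSemilocalOfDimZero (R ⧸ I))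
    (hN : IsGabrielTorsion (R := R) U N)
    {m : Ideal R} {s : R} (hs : s ∈ m) (x : localPart N m) : ∃ n : ℕ, s ^ n • x = 0 := by
  obtain ⟨n, hn⟩ := exists_pow_mem_of_mem_gabrielFilter hG (hN x) (a := s)
    fun M hM hle => x.2 M hM hle ▸ hs
  exact ⟨n, Subtype.ext ((Ideal.mem_torsionOf_iff _ _).1 hn)⟩

end Torsion

end

/-! ### Products of contramodules over the maximal ideals of the filter -/

section

variable {R U : Type u} [CommRing R] [CommRing U] [Algebra R U]

variable (R U) in
/-- `D` is isomorphic to a product `∏ Dₘ` over the maximal ideals `m` in the Gabriel filter, where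
`Dₘ` is a contramodule with respect to all elements of `m`. -/
def IsLocalProduct (D : Type u) [AddCommGroup D] [Module R D] : Prop :=
  ∃ (A : GabrielMaximal R U → Type u) (_ : ∀ m, AddCommGroup (A m)) (_ : ∀ m, Module R (A m)),
    (∀ m : GabrielMaximal R U, ∀ s ∈ m.1.asIdeal, IsContramodule (D := A m) s) ∧
      Nonempty (D ≃ₗ[R] ∀ m, A m)

section Maps

variable {A B : GabrielMaximal R U → Type u} [∀ m, AddCommGroup (A m)] [∀ m, Module R (A m)]
  [∀ m, AddCommGroup (B m)] [∀ m, Module R (B m)]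

/-- Maps from a local product to an `m`-contramodule factor through the `m`-th component. -/
theorem linearMap_pi_eq_zero_of_apply_eq_zero
    (hG : ∀ I ∈ gabrielFilter R U, IsSemilocalOfDimZero (R ⧸ I))
    (hA : ∀ m : GabrielMaximal R U, ∀ s ∈ m.1.asIdeal, IsContramodule (D := A m) s)
    (m : GabrielMaximal R U) {C : Type u} [AddCommGroup C] [Module R C]
    (hC : ∀ s ∈ m.1.asIdeal, IsContramodule (D := C) s) (f : (∀ m, A m) →ₗ[R] C)
    (x : ∀ m, A m) (hx : x m = 0) : f x = 0 := by
  classical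
  obtain ⟨n, v, hvm, -, hv⟩ := exists_generators_of_gabrielMaximal hG m
  let N := LinearMap.ker (LinearMap.proj (R := R) (φ := A) m)
  have hl : {x | x ∈ List.ofFn v} = Set.range v := by
    ext; simp [List.mem_ofFn]
  have key : f ∘ₗ N.subtype = 0 := by
    refine linearMap_eq_zero_of_le_smul_top (List.ofFn v) ⊥ ?_ ?_ ?_ _
    · intro a ha x
      rw [(Submodule.mem_bot R).1 ha, zero_smul]
    · intro s hs
      obtain ⟨i, rfl⟩ := (List.mem_ofFn' _ _).1 hs
      exact hC _ (hvm i)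
    · rw [bot_sup_eq, hl]
      rintro ⟨x, hx⟩ -
      have hx0 : x m = 0 := hx
      -- For `j ≠ m` the generators `v` and `j` are comaximal: `a + b = 1` with `b ∈ j`. As `1 - b`
      -- is onto on the `b`-contramodule `A j`, each `y` there is `a • z`. The number of generators
      -- does not depend on `j`, so the product over `j ≠ m` equals its multiple by the ideal of
      -- `v`, and Nakayama applies.
      have hcomp (j : GabrielMaximal R U) (y : A j) (hy : j = m → y = 0) :
          ∃ c : Fin n → A j, y = ∑ i, v i • c i ∧ (j = m → c = 0) := by
        by_cases hj : j = m
        · exact ⟨0, by simp [hy hj], fun _ => rfl⟩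
        · have hcop : Ideal.span (Set.range v) ⊔ j.1.asIdeal = ⊤ := by
            rw [sup_comm]
            refine Ideal.isMaximal_def.1 j.1.isMaximal |>.2 _ (lt_of_le_of_ne le_sup_left ?_)
            intro h
            refine hj (Subtype.ext (MaximalSpectrum.ext (hv _ j.1.isMaximal ?_)))
            rw [h]
            exact le_sup_right
          obtain ⟨a, ha, b, hb, hab⟩ := Submodule.mem_sup.1 ((Ideal.eq_top_iff_one _).1 hcop)
          obtain ⟨c, hc⟩ := (Submodule.mem_span_range_iff_exists_fun R).1 ha
          obtain ⟨z, hz⟩ := (hA j b hb).exists_sub_smul_eq y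
          refine ⟨fun i => c i • z, ?_, fun h => absurd h hj⟩
          have : a = 1 - b := eq_sub_of_add_eq hab
          rw [hz]
          conv_lhs => rw [← one_smul R z, smul_smul, mul_one, ← sub_smul, ← this, ← hc,
            Finset.sum_smul]
          refine Finset.sum_congr rfl fun i _ => ?_
          rw [smul_eq_mul, mul_comm, mul_smul]
      choose c hc hcm using fun j => hcomp j (x j) (fun h => by subst h; exact hx0)
      have hcN (i : Fin n) : (fun j => c j i) ∈ N := congrFun (hcm m rfl) i
      have hsum : (⟨x, hx⟩ : N) = ∑ i, v i • (⟨fun j => c j i, hcN i⟩ : N) := by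
        refine Subtype.ext (funext fun j => (hc j).trans ?_)
        rw [Submodule.coe_sum, Finset.sum_apply]
        rfl
      rw [hsum]
      exact Submodule.sum_mem _ fun i _ =>
        Submodule.smul_mem_smul (Ideal.subset_span ⟨i, rfl⟩) Submodule.mem_top
  exact LinearMap.congr_fun key ⟨x, hx⟩

/-- Maps between local products are diagonal. -/
theorem exists_eq_pi_of_localProduct
    (hG : ∀ I ∈ gabrielFilter R U, IsSemilocalOfDimZero (R ⧸ I))
    (hA : ∀ m : GabrielMaximal R U, ∀ s ∈ m.1.asIdeal, IsContramodule (D := A m) s)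
    (hB : ∀ m : GabrielMaximal R U, ∀ s ∈ m.1.asIdeal, IsContramodule (D := B m) s)
    (f : (∀ m, A m) →ₗ[R] ∀ m, B m) :
    ∃ g : ∀ m, A m →ₗ[R] B m, ∀ x m, f x m = g m (x m) := by
  classical
  refine ⟨fun m => LinearMap.proj m ∘ₗ f ∘ₗ LinearMap.single R A m, fun x m => ?_⟩
  have := linearMap_pi_eq_zero_of_apply_eq_zero hG hA m (hB m) (LinearMap.proj m ∘ₗ f)
    (x - Pi.single m (x m)) (by simp)
  rw [map_sub, sub_eq_zero] at this
  exact this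

end Maps

variable {A B : Type u} [AddCommGroup A] [Module R A] [AddCommGroup B] [Module R B]

theorem IsLocalProduct.exists_diagonal
    (hG : ∀ I ∈ gabrielFilter R U, IsSemilocalOfDimZero (R ⧸ I))
    (hA : IsLocalProduct R U A) (hB : IsLocalProduct R U B) (f : A →ₗ[R] B) :
    ∃ (A' B' : GabrielMaximal R U → Type u) (_ : ∀ m, AddCommGroup (A' m))
      (_ : ∀ m, Module R (A' m)) (_ : ∀ m, AddCommGroup (B' m)) (_ : ∀ m, Module R (B' m))
      (eA : A ≃ₗ[R] ∀ m, A' m) (eB : B ≃ₗ[R] ∀ m, B' m) (g : ∀ m, A' m →ₗ[R] B' m),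
      (∀ m : GabrielMaximal R U, ∀ s ∈ m.1.asIdeal, IsContramodule (D := A' m) s) ∧
      (∀ m : GabrielMaximal R U, ∀ s ∈ m.1.asIdeal, IsContramodule (D := B' m) s) ∧
      ∀ x m, eB (f x) m = g m (eA x m) := by
  obtain ⟨A', i1, i2, hA', ⟨eA⟩⟩ := hA
  obtain ⟨B', i3, i4, hB', ⟨eB⟩⟩ := hB
  obtain ⟨g, hg⟩ := exists_eq_pi_of_localProduct hG hA' hB'
    (eB.toLinearMap ∘ₗ f ∘ₗ eA.symm.toLinearMap)
  exact ⟨A', B', i1, i2, i3, i4, eA, eB, g, hA', hB', fun x m => by simpa using hg (eA x) m⟩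

theorem IsLocalProduct.ker
    (hG : ∀ I ∈ gabrielFilter R U, IsSemilocalOfDimZero (R ⧸ I))
    (hA : IsLocalProduct R U A) (hB : IsLocalProduct R U B) (f : A →ₗ[R] B) :
    IsLocalProduct R U (LinearMap.ker f) := by
  obtain ⟨A', B', i1, i2, i3, i4, eA, eB, g, hA', hB', hg⟩ := hA.exists_diagonal hG hB f
  refine ⟨fun m => LinearMap.ker (g m), inferInstance, inferInstance,
    fun m s hs => (hA' m s hs).ker (hB' m s hs) (g m), ⟨?_⟩⟩
  let F : LinearMap.ker f →ₗ[R] ∀ m, LinearMap.ker (g m) :=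
    LinearMap.pi fun m => (LinearMap.proj m ∘ₗ eA.toLinearMap ∘ₗ
      (LinearMap.ker f).subtype).codRestrict _ fun x => by
        change g m (eA x m) = 0
        rw [← hg, LinearMap.map_coe_ker, map_zero, Pi.zero_apply]
  refine LinearEquiv.ofBijective F ⟨?_, ?_⟩
  · intro x y hxy
    refine Subtype.ext (eA.injective (funext fun m => ?_))
    exact congrArg Subtype.val (congrFun hxy m)
  · intro z
    refine ⟨⟨eA.symm fun m => z m, ?_⟩, ?_⟩
    · refine eB.injective (funext fun m => ?_)
      rw [hg]
      simp
    · refine funext fun m => Subtype.ext ?_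
      change eA (eA.symm fun m => (z m : A' m)) m = z m
      simp

theorem IsLocalProduct.quotient_range
    (hG : ∀ I ∈ gabrielFilter R U, IsSemilocalOfDimZero (R ⧸ I))
    (hA : IsLocalProduct R U A) (hB : IsLocalProduct R U B) (f : A →ₗ[R] B) :
    IsLocalProduct R U (B ⧸ LinearMap.range f) := by
  obtain ⟨A', B', i1, i2, i3, i4, eA, eB, g, hA', hB', hg⟩ := hA.exists_diagonal hG hB f
  refine ⟨fun m => B' m ⧸ LinearMap.range (g m), inferInstance, inferInstance,
    fun m s hs => (hA' m s hs).quotient_range (hB' m s hs) (g m), ⟨?_⟩⟩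
  let F : B →ₗ[R] ∀ m, B' m ⧸ LinearMap.range (g m) :=
    LinearMap.pi fun m => (LinearMap.range (g m)).mkQ ∘ₗ LinearMap.proj m ∘ₗ eB.toLinearMap
  have hF : Function.Surjective F := by
    intro z
    choose y hy using fun m => Submodule.mkQ_surjective _ (z m)
    refine ⟨eB.symm y, funext fun m => ?_⟩
    rw [← hy m]
    simp [F]
  have hker : LinearMap.range f = LinearMap.ker F := by
    ext y
    constructor
    · rintro ⟨x, rfl⟩
      refine funext fun m => (Submodule.Quotient.mk_eq_zero _).2 ⟨eA x m, ?_⟩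
      exact (hg x m).symm
    · intro hy
      choose x hx using fun m => (Submodule.Quotient.mk_eq_zero _).1 (congrFun hy m)
      refine ⟨eA.symm x, eB.injective (funext fun m => ?_)⟩
      rw [hg, LinearEquiv.apply_symm_apply]
      exact hx m
  exact (Submodule.quotEquivOfEq _ _ hker).trans (F.quotKerEquivOfSurjective hF)

/-- `Hom` turns the local decomposition of `N` into a product, and each element of `m` acts locally
nilpotently on the part at `m`. -/
theorem isLocalProduct_linearMap
    (hG : ∀ I ∈ gabrielFilter R U, IsSemilocalOfDimZero (R ⧸ I))
    {N : Type u} [AddCommGroup N] [Module R N] (hN : IsGabrielTorsion (R := R) U N)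
    (X : Type u) [AddCommGroup X] [Module R X] : IsLocalProduct R U (N →ₗ[R] X) := by
  classical
  refine ⟨fun m => localPart N m.1.asIdeal →ₗ[R] X, inferInstance, inferInstance,
    fun m s hs => IsContramodule.linearMap_of_nilpotent
      (exists_pow_smul_eq_zero_of_mem_localPart hG hN hs), ⟨?_⟩⟩
  let e := LinearEquiv.ofBijective
    (DirectSum.coeLinearMap fun m : GabrielMaximal R U => localPart N m.1.asIdeal)
    (isInternal_localPart hG hN)
  exact (LinearEquiv.congrLeft X R e.symm).trans (DFinsupp.lsum R).symm

theorem extOneVanishes_of_isLocalProduct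
    (hG : ∀ I ∈ gabrielFilter R U, IsSemilocalOfDimZero (R ⧸ I))
    {F : Type u} [AddCommGroup F] [Module R F] [Module.Flat R F]
    (hF : ∀ I ∈ gabrielFilter R U, Module.Projective (R ⧸ I) ((R ⧸ I) ⊗[R] F))
    (hA : IsLocalProduct R U A) : ExtOneVanishes R F A := by
  obtain ⟨A', i1, i2, hA', ⟨e⟩⟩ := hA
  refine (ExtOneVanishes.pi fun m => ?_).of_linearEquiv e.symm
  obtain ⟨n, v, hvm, hvG, -⟩ := exists_generators_of_gabrielMaximal hG m
  have := hF _ hvG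
  refine extOneVanishes_of_isContramodule (Ideal.span (Set.range v)) (List.ofFn v) ⊥ ?_ F _ ?_ ?_
  · rw [bot_sup_eq]
    congr 1
    ext; simp [List.mem_ofFn]
  · intro a ha x
    rw [(Submodule.mem_bot R).1 ha, zero_smul]
  · intro s hs
    obtain ⟨i, rfl⟩ := (List.mem_ofFn' _ _).1 hs
    exact hA' m _ (hvm i)

end

/-! ### The kernel and cokernel of `R → U` -/

section

variable {R U : Type u} [CommRing R] [CommRing U] [Algebra R U]

/-- The cyclic submodule generated by `x` is `R` modulo its annihilator; by flatness its tensor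
product with `U` embeds into `N ⊗ U` with zero image. -/
theorem isGabrielTorsion_of_tmul_eq_zero [Module.Flat R U] {N : Type u} [AddCommGroup N]
    [Module R N] (h : ∀ (x : N) (v : U), x ⊗ₜ[R] v = 0) : IsGabrielTorsion (R := R) U N := by
  intro x
  let j : (R ⧸ Ideal.torsionOf R N x) →ₗ[R] N :=
    (Ideal.torsionOf R N x).liftQ (LinearMap.toSpanSingleton R N x) le_rfl
  have hj : Function.Injective j :=
    LinearMap.ker_eq_bot.1 (Submodule.ker_liftQ_eq_bot _ _ _ le_rfl)
  have hjU := Module.Flat.rTensor_preserves_injective_linearMap (M := U) j hj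
  have h0 : j.rTensor U = 0 := by
    refine TensorProduct.ext' fun y v => ?_
    rw [LinearMap.rTensor_tmul, h]
    rfl
  refine ⟨fun y z => hjU ?_⟩
  rw [h0]
  rfl

variable (R U) in
theorem isGabrielTorsion_ker [Module.Flat R U] :
    IsGabrielTorsion (R := R) U (LinearMap.ker (Algebra.linearMap R U)) := by
  refine isGabrielTorsion_of_tmul_eq_zero fun x v => ?_
  refine Module.Flat.rTensor_preserves_injective_linearMap (M := U)
    (LinearMap.ker (Algebra.linearMap R U)).subtype (Submodule.subtype_injective _) ?_
  refine (TensorProduct.lid R U).injective ?_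
  have hx : algebraMap R U x = 0 := x.2
  rw [LinearMap.rTensor_tmul, Submodule.subtype_apply, TensorProduct.lid_tmul, Algebra.smul_def,
    hx, zero_mul, map_zero, map_zero]

theorem mkQ_range_one : (LinearMap.range (Algebra.linearMap R U)).mkQ 1 = 0 :=
  (Submodule.Quotient.mk_eq_zero _).2 ⟨1, by simp⟩

variable (R U) in
theorem isGabrielTorsion_quotient_range [Module.Flat R U] [Algebra.IsEpi R U] :
    IsGabrielTorsion (R := R) U (U ⧸ LinearMap.range (Algebra.linearMap R U)) := by
  refine isGabrielTorsion_of_tmul_eq_zero fun x v => ?_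
  obtain ⟨x, rfl⟩ := Submodule.mkQ_surjective _ x
  have h1 : x ⊗ₜ[R] v = 1 ⊗ₜ[R] (v * x) := by
    calc x ⊗ₜ[R] v = (x ⊗ₜ[R] 1) * (1 ⊗ₜ[R] v) := by simp
      _ = (1 ⊗ₜ[R] x) * (1 ⊗ₜ[R] v) := by
        rw [(Algebra.isEpi_iff_forall_one_tmul_eq R U).1 inferInstance x]
      _ = 1 ⊗ₜ[R] (v * x) := by simp [mul_comm]
  have h2 := congrArg ((LinearMap.range (Algebra.linearMap R U)).mkQ.rTensor U) h1
  rw [LinearMap.rTensor_tmul, LinearMap.rTensor_tmul] at h2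
  rw [h2, mkQ_range_one, zero_tmul]

variable (R) in
theorem exists_injective_embedding (X : Type u) [AddCommGroup X] [Module R X] :
    ∃ (E : Type u) (_ : AddCommGroup E) (_ : Module R E) (i : X →ₗ[R] E),
      Module.Injective R E ∧ Function.Injective i := by
  have := ModuleCat.enoughInjectives.{u} R
  let M : ModuleCat.{u} R := ModuleCat.of R X
  let E : ModuleCat.{u} R := Injective.under M
  have : Injective (ModuleCat.of R E) := inferInstanceAs (Injective (Injective.under M))
  exact ⟨E, inferInstance, inferInstance, (Injective.ι M).hom,
    Module.injective_module_of_injective_object R E,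
    (ModuleCat.mono_iff_injective (Injective.ι M)).1 inferInstance⟩

section

variable {X : Type u} [AddCommGroup X] [Module R X]

theorem exists_comp_mkQ_eq (g : U →ₗ[R] X) (hg : g 1 = 0) :
    ∃ k : (U ⧸ LinearMap.range (Algebra.linearMap R U)) →ₗ[R] X,
      k ∘ₗ (LinearMap.range (Algebra.linearMap R U)).mkQ = g := by
  refine ⟨(LinearMap.range (Algebra.linearMap R U)).liftQ g ?_, Submodule.liftQ_mkQ _ _ _⟩
  rintro _ ⟨r, rfl⟩
  rw [LinearMap.mem_ker, Algebra.linearMap_apply, Algebra.algebraMap_eq_smul_one, map_smul, hg,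
    smul_zero]

theorem smul_apply_one_eq_zero (g : U →ₗ[R] X)
    (t : LinearMap.ker (Algebra.linearMap R U)) : (t : R) • g 1 = 0 := by
  have ht : algebraMap R U t = 0 := t.2
  rw [← map_smul, ← Algebra.algebraMap_eq_smul_one, ht, map_zero]

/-- The condition on `x` defines a map on the image of `R` in `U`; injectivity of `X` extends it to
`U`. -/
theorem exists_linearMap_apply_one_eq [Module.Injective R X] (x : X)
    (hx : ∀ t : LinearMap.ker (Algebra.linearMap R U), (t : R) • x = 0) :
    ∃ g : U →ₗ[R] X, g 1 = x := by
  obtain ⟨c, hc⟩ := LinearMap.exists_comp_eq_of_ker_le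
    (Algebra.linearMap R U).surjective_rangeRestrict (LinearMap.toSpanSingleton R X x)
    (fun t ht => hx ⟨t, by simpa using ht⟩)
  obtain ⟨g, hg⟩ := Module.Injective.extension_property R _ _ _
    (LinearMap.range (Algebra.linearMap R U)).subtype (Submodule.subtype_injective _) c
  refine ⟨g, ?_⟩
  have h1 := LinearMap.congr_fun hg ((Algebra.linearMap R U).rangeRestrict 1)
  have h2 := LinearMap.congr_fun hc 1
  simp only [LinearMap.comp_apply] at h1 h2
  rw [h2] at h1
  simpa using h1

end

variable (X : Type u) [AddCommGroup X] [Module R X]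

variable (R U) in
/-- The elements of `X` annihilated by the kernel of `R → U`. -/
abbrev kerTorsion : Submodule R X :=
  Submodule.torsionBySet R X (LinearMap.ker (Algebra.linearMap R U) : Set R)

/-- The quotient of the `ker (R → U)`-torsion of `X` by the image of `Hom(U, X)` embeds into a
local product, and is one if `X` is weakly cotorsion. -/
theorem exists_kerTorsion_to_localProduct [Module.Flat R U] [Algebra.IsEpi R U]
    (hG : ∀ I ∈ gabrielFilter R U, IsSemilocalOfDimZero (R ⧸ I)) :
    ∃ (Z : Type u) (_ : AddCommGroup Z) (_ : Module R Z) (θ : kerTorsion R U X →ₗ[R] Z),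
      IsLocalProduct R U Z ∧ (∀ x, θ x = 0 ↔ ∃ g : U →ₗ[R] X, g 1 = x) ∧
      (ExtOneVanishes R U X → Function.Surjective θ) := by
  obtain ⟨E, _, _, i, hE, hi⟩ := exists_injective_embedding R X
  let π := (LinearMap.range i).mkQ
  have hπ : Function.Surjective π := Submodule.mkQ_surjective _
  have hiπ : Function.Exact i π := LinearMap.exact_map_mkQ_range i
  let q := (LinearMap.range (Algebra.linearMap R U)).mkQ
  have hq : Function.Surjective q := Submodule.mkQ_surjective _
  let K := U ⧸ LinearMap.range (Algebra.linearMap R U)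
  -- The cokernel of `c` is `Ext¹(K, X)`, and `θ` is a connecting map: extend `x` to `y : U → E`
  -- with `y 1 = i x`, then reduce modulo `X` to a map on `K`.
  let c : (K →ₗ[R] E) →ₗ[R] (K →ₗ[R] (E ⧸ LinearMap.range i)) := LinearMap.compRight R π
  let Y : Submodule R (U →ₗ[R] E) := (LinearMap.range i).comap (LinearMap.applyₗ (1 : U))
  obtain ⟨a₀, ha₀⟩ := LinearMap.exists_comp_eq_of_mem_range hi
    (LinearMap.applyₗ (1 : U) ∘ₗ Y.subtype) fun y => y.2
  have ha₀' (y : Y) : i (a₀ y) = y.1 1 := LinearMap.congr_fun ha₀ y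
  let a : Y →ₗ[R] kerTorsion R U X := a₀.codRestrict _ fun y => by
    rw [Submodule.mem_torsionBySet_iff]
    intro t
    refine hi ?_
    rw [map_smul, ha₀', map_zero]
    exact smul_apply_one_eq_zero y.1 t
  have ha (y : Y) : i (a y) = y.1 1 := ha₀' y
  have hasurj : Function.Surjective a := by
    intro x
    obtain ⟨g, hg⟩ := exists_linearMap_apply_one_eq (U := U) (i x) fun t => by
      rw [← map_smul, (Submodule.mem_torsionBySet_iff _ _).1 x.2 t, map_zero]
    exact ⟨⟨g, x, hg.symm⟩, Subtype.ext (hi ((ha _).trans hg))⟩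
  have hinj : Function.Injective
      (LinearMap.lcomp R (E ⧸ LinearMap.range i) q) := by
    intro f g hfg
    exact LinearMap.ext fun x => by
      obtain ⟨x, rfl⟩ := hq x
      exact LinearMap.congr_fun hfg x
  obtain ⟨b, hb⟩ := LinearMap.exists_comp_eq_of_mem_range hinj
    (LinearMap.compRight R π ∘ₗ Y.subtype) fun y => by
      obtain ⟨k, hk⟩ := exists_comp_mkQ_eq (π ∘ₗ y.1) ((hiπ _).2 y.2)
      exact ⟨k, hk⟩
  have hb' (y : Y) (v : U) : b y (q v) = π (y.1 v) :=
    LinearMap.congr_fun (LinearMap.congr_fun hb y) v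
  have hzero (y : Y) : (LinearMap.range c).mkQ (b y) = 0 ↔ ∃ k : K →ₗ[R] E,
      ∀ v, π (k (q v)) = π (y.1 v) := by
    rw [Submodule.mkQ_apply, Submodule.Quotient.mk_eq_zero]
    constructor
    · rintro ⟨k, hk⟩
      exact ⟨k, fun v => (LinearMap.congr_fun hk (q v)).trans (hb' y v)⟩
    · rintro ⟨k, hk⟩
      refine ⟨k, LinearMap.ext fun x => ?_⟩
      obtain ⟨v, rfl⟩ := hq x
      exact (hk v).trans (hb' y v).symm
  obtain ⟨θ, hθ⟩ := LinearMap.exists_comp_eq_of_ker_le hasurj ((LinearMap.range c).mkQ ∘ₗ b) (by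
    intro y hy
    have hy1 : y.1 1 = 0 := by
      rw [← ha, LinearMap.mem_ker.1 hy]
      simp
    obtain ⟨k, hk⟩ := exists_comp_mkQ_eq y.1 hy1
    exact (hzero y).2 ⟨k, fun v => congrArg π (LinearMap.congr_fun hk v)⟩)
  have hθ' (y : Y) : θ (a y) = (LinearMap.range c).mkQ (b y) := LinearMap.congr_fun hθ y
  have hK := isGabrielTorsion_quotient_range R U
  refine ⟨_, inferInstance, inferInstance, θ,
    (isLocalProduct_linearMap hG hK _).quotient_range hG (isLocalProduct_linearMap hG hK _) c,
    fun x => ?_, fun hX z => ?_⟩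
  · constructor
    · intro hx
      obtain ⟨y, rfl⟩ := hasurj x
      rw [hθ', hzero] at hx
      obtain ⟨k, hk⟩ := hx
      obtain ⟨g, hg⟩ := LinearMap.exists_comp_eq_of_mem_range hi (y.1 - k ∘ₗ q) fun v => by
        refine (hiπ _).1 ?_
        rw [LinearMap.sub_apply, map_sub, LinearMap.comp_apply, hk, sub_self]
      refine ⟨g, hi ?_⟩
      have := LinearMap.congr_fun hg 1
      rw [LinearMap.comp_apply, LinearMap.sub_apply, LinearMap.comp_apply,
        show q 1 = 0 from mkQ_range_one, map_zero, sub_zero] at this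
      rw [ha, this]
    · rintro ⟨g, hg⟩
      have hx : a ⟨i ∘ₗ g, g 1, rfl⟩ = x := Subtype.ext (hi ((ha _).trans (congrArg i hg)))
      rw [← hx, hθ', hzero]
      exact ⟨0, fun v => by simpa using (hiπ.apply_apply_eq_zero (g v)).symm⟩
  · obtain ⟨ψ, rfl⟩ := Submodule.mkQ_surjective _ z
    -- `Ext¹(U, X) = 0` lifts the pullback of `ψ` to `U`; the lift sends `1` into `X` and so gives a
    -- preimage under `θ`.
    obtain ⟨g, hg⟩ := hX.exists_lift hi hiπ hπ (ψ ∘ₗ q)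
    have hg1 : g 1 ∈ LinearMap.range i := by
      refine (hiπ _).1 ((LinearMap.congr_fun hg 1).trans ?_)
      rw [LinearMap.comp_apply, show q 1 = 0 from mkQ_range_one, map_zero]
    refine ⟨a ⟨g, hg1⟩, ?_⟩
    rw [hθ']
    congr 1
    refine LinearMap.ext fun x => ?_
    obtain ⟨v, rfl⟩ := hq x
    exact (hb' _ v).trans (LinearMap.congr_fun hg v)

end

/-! ### Decomposition of a weakly cotorsion module and conclusion -/

section

variable {R U : Type u} [CommRing R] [CommRing U] [Algebra R U]

theorem extOneVanishes_linearMap_of_projective [Module.Flat R U]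
    {F : Type u} [AddCommGroup F] [Module R F] [Module.Projective U (U ⊗[R] F)]
    (C : Type u) [AddCommGroup C] [Module R C] : ExtOneVanishes R F (U →ₗ[R] C) := by
  let _ : Module U (U →ₗ[R] C) :=
    { smul := fun u f => f ∘ₗ LinearMap.mulLeft R u
      one_smul := fun f => LinearMap.ext fun v => congrArg f (one_mul v)
      mul_smul := fun u w f => LinearMap.ext fun v =>
        congrArg f (show u * w * v = w * (u * v) by ring)
      smul_zero := fun u => rfl
      smul_add := fun u f g => rfl
      add_smul := fun u w f => LinearMap.ext fun v =>
        (congrArg f (add_mul u w v)).trans (map_add f _ _)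
      zero_smul := fun f => LinearMap.ext fun v =>
        (congrArg f (zero_mul v)).trans (map_zero f) }
  have : IsScalarTower R U (U →ₗ[R] C) :=
    ⟨fun r u f => LinearMap.ext fun v =>
      (congrArg f (smul_mul_assoc r u v)).trans (map_smul f _ _)⟩
  exact ExtOneVanishes.of_projective_baseChange U
    (Module.Flat.lTensor_preserves_injective_linearMap _ (syzygyInclusion_injective R F)) _

/-- If `C` is weakly cotorsion, then the quotient of `C` by its `ker (R → U)`-torsion is a local
product. -/
theorem exists_surjective_localProduct_of_extOneVanishes [Module.Flat R U] [Algebra.IsEpi R U]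
    (hG : ∀ I ∈ gabrielFilter R U, IsSemilocalOfDimZero (R ⧸ I))
    (C : Type u) [AddCommGroup C] [Module R C] (hC : ExtOneVanishes R U C) :
    ∃ (B : Type u) (_ : AddCommGroup B) (_ : Module R B) (p : C →ₗ[R] B),
      IsLocalProduct R U B ∧ Function.Surjective p ∧
      Function.Exact (kerTorsion R U C).subtype p := by
  obtain ⟨E, _, _, i, hE, hi⟩ := exists_injective_embedding R C
  let π := (LinearMap.range i).mkQ
  have hπ : Function.Surjective π := Submodule.mkQ_surjective _
  have hiπ : Function.Exact i π := LinearMap.exact_map_mkQ_range i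
  let T := LinearMap.ker (Algebra.linearMap R U)
  -- Applied to `E/C`, this gives `Z` in the role of `Ext¹(K, E/C) = Ext²(K, C)`.
  obtain ⟨Z, _, _, θ, hZ, hθ, -⟩ :=
    exists_kerTorsion_to_localProduct (U := U) (E ⧸ LinearMap.range i) hG
  let μ : C →ₗ[R] T →ₗ[R] C :=
    LinearMap.lcomp R C T.subtype ∘ₗ (LinearMap.lsmul R C).flip
  have hμ (c : C) (t : T) : μ c t = (t : R) • c := rfl
  let ν : E →ₗ[R] T →ₗ[R] E :=
    LinearMap.lcomp R E T.subtype ∘ₗ (LinearMap.lsmul R E).flip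
  have hν (e : E) (t : T) : ν e t = (t : R) • e := rfl
  let V : Submodule R E := (LinearMap.range (LinearMap.compRight R (M := T) i)).comap ν
  have hinj : Function.Injective (LinearMap.compRight R (M := T) i) := fun f g h =>
    LinearMap.ext fun t => hi (LinearMap.congr_fun h t)
  obtain ⟨a, ha⟩ := LinearMap.exists_comp_eq_of_mem_range hinj (ν ∘ₗ V.subtype) fun y => y.2
  have ha' (e : V) (t : T) : i (a e t) = (t : R) • (e : E) :=
    LinearMap.congr_fun (LinearMap.congr_fun ha e) t
  have hasurj : Function.Surjective a := by
    intro φ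
    obtain ⟨k, hk⟩ := Module.Injective.extension_property R _ _ _ T.subtype
      (Submodule.subtype_injective _) (i ∘ₗ φ)
    have hkt (t : T) : i (φ t) = (t : R) • k 1 := by
      rw [← map_smul, smul_eq_mul, mul_one]
      exact (LinearMap.congr_fun hk t).symm
    refine ⟨⟨k 1, φ, LinearMap.ext hkt⟩, LinearMap.ext fun t => hi ?_⟩
    rw [ha', hkt]
  let b : V →ₗ[R] kerTorsion R U (E ⧸ LinearMap.range i) :=
    (π ∘ₗ V.subtype).codRestrict _ fun e => by
      rw [Submodule.mem_torsionBySet_iff]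
      intro t
      rw [LinearMap.comp_apply, ← map_smul]
      exact (hiπ _).2 ⟨a e t, ha' e t⟩
  have hb (e : V) : (b e : E ⧸ LinearMap.range i) = π e := rfl
  -- The map `Hom(T, C) → Ext²(K, C)`: write `φ` as multiplication on some `e` in `E`, then apply
  -- `θ` to the class of `e` modulo `C`. Changing `e` by an element killed by `T` does not matter,
  -- as that element is the value at `1` of a map from `U`.
  obtain ⟨δ, hδ⟩ := LinearMap.exists_comp_eq_of_ker_le hasurj (θ ∘ₗ b) (by
    intro e he
    obtain ⟨k, hk⟩ := exists_linearMap_apply_one_eq (U := U) (e : E) fun t => by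
      rw [← ha', LinearMap.mem_ker.1 he, LinearMap.zero_apply, map_zero]
    exact (hθ _).2 ⟨π ∘ₗ k, by rw [LinearMap.comp_apply, hk, hb]⟩)
  have hδ' (e : V) : δ (a e) = θ (b e) := LinearMap.congr_fun hδ e
  have hδμ (c : C) : δ (μ c) = 0 := by
    have hc : i c ∈ V := ⟨μ c, LinearMap.ext fun t => map_smul i _ _⟩
    have hac : a ⟨i c, hc⟩ = μ c := LinearMap.ext fun t => hi (by rw [ha', hμ, map_smul])
    rw [← hac, hδ', hθ]
    exact ⟨0, (hiπ.apply_apply_eq_zero c).symm⟩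
  refine ⟨LinearMap.ker δ, inferInstance, inferInstance, μ.codRestrict _ hδμ,
    (isLocalProduct_linearMap hG (isGabrielTorsion_ker R U) C).ker hG hZ δ, ?_, ?_⟩
  · rintro ⟨φ, hφ⟩
    obtain ⟨e, rfl⟩ := hasurj φ
    rw [LinearMap.mem_ker, hδ', hθ] at hφ
    obtain ⟨g, hg⟩ := hφ
    -- Weak cotorsion lifts `g` to `k : U → E`. Then `e - k 1` comes from `C`, and `T` kills `k 1`,
    -- so it induces the same map on `T` as `e`.
    obtain ⟨k, rfl⟩ := hC.exists_lift hi hiπ hπ g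
    obtain ⟨c, hc⟩ := (hiπ (e - k 1)).1 (by rw [map_sub, ← hb, ← hg]; exact sub_self _)
    refine ⟨c, Subtype.ext (LinearMap.ext fun t => hi ?_)⟩
    change i ((t : R) • c) = i (a e t)
    rw [ha', map_smul, hc, smul_sub, smul_apply_one_eq_zero, sub_zero]
  · intro c
    constructor
    · intro hc
      refine ⟨⟨c, (Submodule.mem_torsionBySet_iff _ _).2 fun t => ?_⟩, rfl⟩
      exact LinearMap.congr_fun (congrArg Subtype.val hc) t
    · rintro ⟨c, rfl⟩
      refine Subtype.ext (LinearMap.ext fun t => ?_)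
      exact (Submodule.mem_torsionBySet_iff _ _).1 c.2 t

theorem extOneVanishes_of_projective [Module.Flat R U] [Algebra.IsEpi R U]
    (hG : ∀ I ∈ gabrielFilter R U, IsSemilocalOfDimZero (R ⧸ I))
    {F : Type u} [AddCommGroup F] [Module R F] [Module.Flat R F]
    [Module.Projective U (U ⊗[R] F)]
    (hF : ∀ I ∈ gabrielFilter R U, Module.Projective (R ⧸ I) ((R ⧸ I) ⊗[R] F))
    (C : Type u) [AddCommGroup C] [Module R C] (hC : ExtOneVanishes R U C) :
    ExtOneVanishes R F C := by
  obtain ⟨B, _, _, p, hB, hp, hpe⟩ := exists_surjective_localProduct_of_extOneVanishes hG C hC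
  obtain ⟨Z, _, _, θ, hZ, hθ, hθs⟩ := exists_kerTorsion_to_localProduct (U := U) C hG
  refine ExtOneVanishes.of_exact ?_ (extOneVanishes_of_isLocalProduct hG hF hB)
    (Submodule.subtype_injective _) hpe hp
  let ev : (U →ₗ[R] C) →ₗ[R] C := LinearMap.applyₗ (1 : U)
  have hle : LinearMap.range ev ≤ kerTorsion R U C := by
    rintro _ ⟨g, rfl⟩
    exact (Submodule.mem_torsionBySet_iff _ _).2 fun t => smul_apply_one_eq_zero g t
  refine ExtOneVanishes.of_exact (i := Submodule.inclusion hle) (p := θ) ?_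
    (extOneVanishes_of_isLocalProduct hG hF hZ) (Submodule.inclusion_injective hle) ?_ (hθs hC)
  · have := flat_syzygy (R := R) (F := F)
    have hF' : ∀ I ∈ gabrielFilter R U,
        Module.Projective (R ⧸ I) ((R ⧸ I) ⊗[R] Syzygy R F) := fun I hI => by
      have := hF I hI
      exact projective_baseChange_syzygy _
    let q := (LinearMap.range (Algebra.linearMap R U)).mkQ
    -- The image of `Hom(U, C)` is its quotient by `Hom(K, C)`, whose `Ext²` vanishes because the
    -- syzygy satisfies (ii).
    refine (extOneVanishes_linearMap_of_projective C).of_surjective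
      (extOneVanishes_of_isLocalProduct hG hF'
        (isLocalProduct_linearMap hG (isGabrielTorsion_quotient_range R U) C))
      (i := LinearMap.lcomp R C q) (p := ev.rangeRestrict) ?_ ?_ ev.surjective_rangeRestrict
    · exact fun f g h => LinearMap.ext fun x => by
        obtain ⟨v, rfl⟩ := Submodule.mkQ_surjective _ x
        exact LinearMap.congr_fun h v
    · intro g
      constructor
      · exact fun hg => exists_comp_mkQ_eq g (congrArg Subtype.val hg)
      · rintro ⟨k, rfl⟩
        refine Subtype.ext ?_
        change k (q 1) = 0
        rw [show q 1 = 0 from mkQ_range_one, map_zero]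
  · intro x
    rw [hθ]
    exact ⟨fun ⟨g, hg⟩ => ⟨⟨x, g, hg⟩, rfl⟩, fun ⟨⟨_, g, hg⟩, hy⟩ => ⟨g, hy ▸ hg⟩⟩

variable (R U) in
-- For an epimorphism, multiplication identifies `U ⊗ U` with the free module `U`.
theorem projective_tensorProduct_self [Algebra.IsEpi R U] : Module.Projective U (U ⊗[R] U) := by
  let f : U ⊗[R] U →ₗ[U] U := (LinearMap.id : U →ₗ[R] U).liftBaseChange U
  have hf : f.restrictScalars R = TensorProduct.lift (LinearMap.mul R U) := by
    ext; simp [f]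
  have hinj : Function.Injective f := by
    have := Algebra.IsEpi.injective_lift_mul (R := R) (A := U)
    rw [← hf] at this
    exact this
  exact Module.Projective.of_equiv
    (LinearEquiv.ofBijective f ⟨hinj, fun u => ⟨1 ⊗ₜ u, by simp [f]⟩⟩).symm

end

theorem theorem6p3 {R U : Type u} [CommRing R] [CommRing U] [Algebra R U]
    [Algebra.IsEpi R U] [Module.Flat R U]
    (hG : ∀ I ∈ gabrielFilter R U, IsSemilocalOfDimZero (R ⧸ I))
    (F : Type u) [AddCommGroup F] [Module R F] [Module.Flat R F] :
    IsStronglyFlat R U F ↔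
      Module.Projective U (U ⊗[R] F) ∧
        ∀ I ∈ gabrielFilter R U, Module.Projective (R ⧸ I) (F ⧸ (I • ⊤ : Submodule R F)) := by
  simp only [IsStronglyFlat, IsWeaklyCotorsion, subsingleton_ext_one_iff, projective_quotient_iff]
  constructor
  · intro h
    refine ⟨projective_baseChange_of_extOneVanishes U fun X => h X ?_,
      fun I hI => projective_baseChange_of_extOneVanishes (R ⧸ I) fun X => h X ?_⟩
    · have := projective_tensorProduct_self R U
      exact ExtOneVanishes.of_projective_baseChange U (syzygy_lTensor_injective (F := U) _) X
    · have : Subsingleton ((R ⧸ I) ⊗[R] U) := hI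
      exact ExtOneVanishes.of_projective_baseChange (R ⧸ I)
        (syzygy_lTensor_injective (F := U) _) X
  · rintro ⟨_, h⟩ C _ _ hC
    exact extOneVanishes_of_projective hG h C hC
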